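/- Setting. Let $h\in L^2(\mathbb{R})$ be a non-negative real-valued window, supported in $[-1/2,1/2]$ and not almost everywhere zero, and let $0<\tau_1<\tau_2$. Let $\mu_3$ be a probability measure on $[\tau_1,\tau_2]$ that is absolutely continuous with respect to Lebesgue measure, and let $a_\tau,b_\tau$ be measurable functions of $\tau\in[\tau_1,\tau_2]$ with $a_\tau<b_\tau$ for all $\tau$ and $\inf_\tau a_\tau>0$. Let $G=\mathbb{R}^2\times[\tau_1,\tau_2]$ with the measure $\mu = dx\,d\omega\,d\mu_3(\tau)$. The LTFT is the system of atoms, indexed by $(x,\omega,\tau)\in G$, $$f_{x,\omega,\tau}(t)=|\sigma|^{-1/2}\,h\big((t-x)/\sigma\big)\,e^{2\pi i\omega(t-x)},\qquad \sigma=\begin{cases}\tau/a_\tau & |\omega|<a_\tau\\ \tau/\omega & a_\tau\le|\omega|\le b_\tau\\ \tau/b_\tau & |\omega|>b_\tau,\end{cases}$$ with coefficient functions $V_f[s](g)=\langle s,f_g\rangle$, for $s\in L^2(\mathbb{R})$ and $g\in G$. Let $R>0$ be such that $b_\tau<R$ for every $\tau\in[\tau_1,\tau_2]$. Let ${\rm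 PW}_R$ be the space of $s\in L^2(\mathbb{R})$ whose Fourier transform vanishes a.e. outside $[-R,R]$. For $M\ge1$ let $V_M^R$ be the space of $q\in L^2(\mathbb{R})$ that vanish outside $(-\frac{M}{2R},\frac{M}{2R})$ and are given there by $q(t)=\sum_{n=-M}^{M}\sqrt{R/M}\,c_n e^{2\pi i n\frac RM t}$ with $c_n\in\mathbb{C}$. For $W>0$ let $\psi_{M}^{R}$ be the indicator function of $$G_{M}^{R}=\Big\{(x,\omega,\tau)\in G \ :\ |\omega|<WR,\ |x|<\frac{M}{2R}+\frac{\tau_2}{a_\tau}\Big\}.$$ Definitions. A system $f:G\to\mathcal H$ in a Hilbert space, over a locally compact space $G$ with a $\sigma$-finite Borel measure, is a continuous frame if for every $s\in\mathcal H$ the function $V_f[s]$ is measurable and lies in $L^2(G)$, and there are $0<A\le B<\infty$ with $A\|s\|^2\le\|V_f[s]\|_2^2\le B\|s\|^2$ for all $s$. A sequence of sets $V_M\subset\mathcal H$ ($M\geq 1$) is a discretization of a class $\mathcal R\subset\mathcal H$ if the linear span of $V_M$ is finite dimensional with dimension between $c_1M$ and $c_2M$ for constants $c_1,c_2>0$,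 and every $s\in\mathcal R$ is a limit of some $s_M\in V_M$. Functions $\psi_M:G\to[0,\infty)$ realize the linear volume property at tolerance $\epsilon$ if there are $C>0$ and $M_0\in\mathbb{N}$ such that for all $M\ge M_0$: $\psi_M\in L^1(G)$, $\|\psi_M\|_1\le CM$, and for all $0\ne s\in V_M$ $$\|V_f[s]-\psi_MV_f[s]\|_2<\epsilon\,\|V_f[s]\|_2 .$$ The continuous frame $f$ is linear volume discretizable with respect to $\mathcal R$ and a discretization $\{V_M\}$ of $\mathcal R$ if for every $\epsilon>0$ there are such $\psi_M$. Proposition. The LTFT is a continuous frame, $\{V_M^R\}_M$ is a discretization of ${\rm PW}_R$, and the LTFT is linear volume discretizable with respect to ${\rm PW}_R$ and $\{V_M^R\}_M$. The envelopes can be taken to be the indicators $\psi_M^R$ with $W$ large: for every $\epsilon>0$ there is $W_0(\epsilon)$, which depends only on $\epsilon$ (and on $h,\tau_1,\tau_2$), such that for every $W\ge W_0(\epsilon)$ the functions $\psi_M^R$ realize the linear volume property of the LTFT at tolerance $\epsilon$. -/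

import Mathlib

open MeasureTheory Filter Topology
open scoped ENNReal FourierTransform

noncomputable section

/-! ## Continuous frames and linear volume discretization -/

section Frames

variable {G : Type*} [TopologicalSpace G] [WeaklyLocallyCompactSpace G]
  [MeasurableSpace G] [BorelSpace G]
variable {H : Type*} [NormedAddCommGroup H] [InnerProductSpace ℂ H] [CompleteSpace H]

/-- The coefficient function `V_f[s](g) = ⟨s, f_g⟩`. The scalar product of the text is linear in
its first argument, Mathlib's `inner` in its second, hence the order of the arguments. -/
def coeffFun (f : G → H) (s : H) (g : G) : ℂ := inner ℂ (f g) s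

/-- Continuous frames over a locally compact space with a `σ`-finite Borel measure. -/
structure IsContinuousFrame (μ : Measure G) [SigmaFinite μ] (f : G → H) : Prop where
  weaklyMeasurable : ∀ s : H, Measurable (coeffFun f s)
  memLp : ∀ s : H, MemLp (coeffFun f s) 2 μ
  bounds : ∃ A B : ℝ, 0 < A ∧ A ≤ B ∧ ∀ s : H,
    A * ‖s‖ ^ 2 ≤ (eLpNorm (coeffFun f s) 2 μ).toReal ^ 2 ∧
      (eLpNorm (coeffFun f s) 2 μ).toReal ^ 2 ≤ B * ‖s‖ ^ 2

/-- A sequence of discrete signal spaces `V_M`, `M ≥ 1`, whose resolution (the dimension of the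
linear span, which is `V_M` itself when `V_M` is a linear space) is finite and proportional
to `M`, and which approximates every signal of the class `𝓡`. -/
structure IsDiscretization (𝓡 : Set H) (V : ℕ → Set H) : Prop where
  finiteDimensional : ∀ M : ℕ, 1 ≤ M → FiniteDimensional ℂ (Submodule.span ℂ (V M))
  resolution : ∃ c₁ c₂ : ℝ, 0 < c₁ ∧ 0 < c₂ ∧ ∀ M : ℕ, 1 ≤ M →
    c₁ * M ≤ (Module.finrank ℂ (Submodule.span ℂ (V M)) : ℝ) ∧
      (Module.finrank ℂ (Submodule.span ℂ (V M)) : ℝ) ≤ c₂ * M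
  approx : ∀ s ∈ 𝓡, ∃ u : ℕ → H, (∀ M : ℕ, 1 ≤ M → u M ∈ V M) ∧ Tendsto u atTop (𝓝 s)

/-- The envelopes `ψ_M` realize the linear volume property of `f` at the error tolerance `ε`:
for all large `M`, `ψ_M` is a nonnegative function in `L¹(G)` with `‖ψ_M‖₁ ≤ C M`, and
`‖V_f[s] - ψ_M V_f[s]‖₂ / ‖V_f[s]‖₂ < ε` for every nonzero `s` in `V_M`. -/
def HasLinearVolumeEnvelopes (μ : Measure G) [SigmaFinite μ] (f : G → H) (V : ℕ → Set H)
    (ψ : ℕ → G → ℝ) (ε : ℝ) : Prop :=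
  ∃ C : ℝ, 0 < C ∧ ∃ M₀ : ℕ, ∀ M : ℕ, M₀ ≤ M →
    (∀ g, 0 ≤ ψ M g) ∧ Integrable (ψ M) μ ∧ ∫ g, |ψ M g| ∂μ ≤ C * M ∧
    ∀ s ∈ V M, s ≠ 0 →
      eLpNorm (fun g => coeffFun f s g - (ψ M g : ℂ) * coeffFun f s g) 2 μ
        < ENNReal.ofReal ε * eLpNorm (coeffFun f s) 2 μ

/-- `f` is a linear volume discretizable (LVD) continuous frame with respect to the class `𝓡`
and the discretization `V`. -/
structure IsLinearVolumeDiscretizable (μ : Measure G) [SigmaFinite μ] (f : G → H)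
    (𝓡 : Set H) (V : ℕ → Set H) : Prop where
  frame : IsContinuousFrame μ f
  discretization : IsDiscretization 𝓡 V
  envelopes : ∀ ε : ℝ, 0 < ε → ∃ ψ : ℕ → G → ℝ, HasLinearVolumeEnvelopes μ f V ψ ε

end Frames

/-! ## The localizing time-frequency transform -/

/-- The signal space `L²(ℝ)`. -/
abbrev SignalSpace : Type := Lp ℂ 2 (volume : Measure ℝ)

/-- Translation `[𝒯(x)s](t) = s(t - x)`. -/
def timeShift (x : ℝ) (s : ℝ → ℂ) (t : ℝ) : ℂ := s (t - x)

/-- Modulation `[ℳ(ω)s](t) = s(t) e^{2πiωt}`. -/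
def freqShift (ω : ℝ) (s : ℝ → ℂ) (t : ℝ) : ℂ :=
  s t * Complex.exp (2 * Real.pi * Complex.I * ω * t)

/-- Dilation `[𝒟(σ)s](t) = |σ|^{-1/2} s(t/σ)`, for `σ ≠ 0` of either sign. -/
def dilation (σ : ℝ) (s : ℝ → ℂ) (t : ℝ) : ℂ := ((Real.sqrt |σ|)⁻¹ : ℝ) * s (σ⁻¹ * t)

/-- The LTFT phase space `ℝ² × [τ₁, τ₂]`, with points `(x, ω, τ)` (time, frequency, number of
oscillations). -/
abbrev LTFTPhaseSpace (τ₁ τ₂ : ℝ) : Type := ℝ × ℝ × Set.Icc τ₁ τ₂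

/-- The measure `dx dω dμ₃(τ)` of the LTFT phase space. -/
abbrev ltftMeasure {τ₁ τ₂ : ℝ} (μ₃ : Measure (Set.Icc τ₁ τ₂)) :
    Measure (LTFTPhaseSpace τ₁ τ₂) :=
  (volume : Measure ℝ).prod ((volume : Measure ℝ).prod μ₃)

/-- The dilation parameter of an LTFT atom, given the transition frequencies
`α = a_τ` and `β = b_τ`. -/
def ltftScale (α β ω τ : ℝ) : ℝ :=
  if |ω| < α then τ / α else if |ω| ≤ β then τ / ω else τ / β

/-- The LTFT atom `𝒯(x) ℳ(ω) 𝒟(σ) h` as a function on `ℝ`. -/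
def ltftAtomFun {τ₁ τ₂ : ℝ} (h : ℝ → ℝ) (a b : Set.Icc τ₁ τ₂ → ℝ)
    (g : LTFTPhaseSpace τ₁ τ₂) : ℝ → ℂ :=
  timeShift g.1 (freqShift g.2.1
    (dilation (ltftScale (a g.2.2) (b g.2.2) g.2.1 g.2.2) (fun t => (h t : ℂ))))

/-- The atom is `|σ|^{-1/2} h((t-x)/σ) e^{2πiω(t-x)}`. -/
theorem ltftAtomFun_apply {τ₁ τ₂ : ℝ} (h : ℝ → ℝ) (a b : Set.Icc τ₁ τ₂ → ℝ)
    (x ω : ℝ) (τ : Set.Icc τ₁ τ₂) (t : ℝ) :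
    ltftAtomFun h a b (x, ω, τ) t =
      ((Real.sqrt |ltftScale (a τ) (b τ) ω τ|)⁻¹ : ℝ) *
        h ((ltftScale (a τ) (b τ) ω τ)⁻¹ * (t - x)) *
        Complex.exp (2 * Real.pi * Complex.I * ω * ((t - x : ℝ) : ℂ)) := rfl

open Classical in
/-- The class in `L²(ℝ)` of a square integrable function (and `0` for other functions; the atoms
are square integrable by `memLp_ltftAtomFun`). -/
def toSignal (u : ℝ → ℂ) : SignalSpace :=
  if hu : MemLp u 2 volume then hu.toLp u else 0

/-- The LTFT system. -/
def ltftAtom {τ₁ τ₂ : ℝ} (h : ℝ → ℝ) (a b : Set.Icc τ₁ τ₂ → ℝ)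
    (g : LTFTPhaseSpace τ₁ τ₂) : SignalSpace :=
  toSignal (ltftAtomFun h a b g)

theorem ltftScale_ne_zero {α β ω τ : ℝ} (hα : 0 < α) (hβ : 0 < β) (hτ : 0 < τ) :
    ltftScale α β ω τ ≠ 0 := by
  unfold ltftScale
  split_ifs with h1 h2
  · positivity
  · have : ω ≠ 0 := by
      rintro rfl
      simp at h1
      linarith
    exact div_ne_zero hτ.ne' this
  · positivity

theorem memLp_ltftAtomFun {τ₁ τ₂ : ℝ} (hτ₁ : 0 < τ₁) {h : ℝ → ℝ} (hh : MemLp h 2 volume)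
    {a b : Set.Icc τ₁ τ₂ → ℝ} (ha : ∀ τ, 0 < a τ) (hb : ∀ τ, 0 < b τ)
    (g : LTFTPhaseSpace τ₁ τ₂) : MemLp (ltftAtomFun h a b g) 2 volume := by
  obtain ⟨x, ω, τ⟩ := g
  have hσ : ltftScale (a τ) (b τ) ω τ ≠ 0 :=
    ltftScale_ne_zero (ha τ) (hb τ) (hτ₁.trans_le τ.2.1)
  generalize hs : ltftScale (a τ) (b τ) ω τ = σ at hσ
  have h0 : MemLp (fun t => (h t : ℂ)) 2 volume := hh.ofReal
  have h1 : MemLp (fun t => (h (σ⁻¹ * t) : ℂ)) 2 volume := by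
    have hi : σ⁻¹ ≠ 0 := inv_ne_zero hσ
    have hm : Measurable (fun t : ℝ => σ⁻¹ * t) := measurable_const_mul _
    have key : MemLp (fun t => (h t : ℂ)) 2
        (Measure.map (fun t : ℝ => σ⁻¹ * t) volume) := by
      rw [Real.map_volume_mul_left hi]
      exact h0.smul_measure ENNReal.ofReal_ne_top
    exact (memLp_map_measure_iff key.1 hm.aemeasurable).1 key
  have h2 : MemLp (freqShift ω (dilation σ (fun t => (h t : ℂ)))) 2 volume := by
    have h3 := h1.const_mul (((Real.sqrt |σ|)⁻¹ : ℝ) : ℂ)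
    refine MemLp.of_le h3 ?_ (ae_of_all _ fun t => ?_)
    · refine AEStronglyMeasurable.mul h3.1 ?_
      exact Continuous.aestronglyMeasurable (by fun_prop)
    · have : ‖Complex.exp (2 * Real.pi * Complex.I * ω * t)‖ = 1 := by
        rw [show (2 * Real.pi * Complex.I * ω * t : ℂ)
          = ((2 * Real.pi * ω * t : ℝ) : ℂ) * Complex.I by push_cast; ring]
        exact Complex.norm_exp_ofReal_mul_I _
      simp only [freqShift, dilation, norm_mul, this, mul_one, le_refl]
  have h4 := h2.comp_measurePreserving (measurePreserving_sub_right volume x)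
  have h5 : ltftAtomFun h a b (x, ω, τ) =
      freqShift ω (dilation σ (fun t => (h t : ℂ))) ∘ (fun t => t - x) := by
    rw [← hs]
    rfl
  rw [h5]
  exact h4

/-! ## The signal class, its discretization, and the envelopes -/

/-- The Paley--Wiener class: signals in `L²(ℝ)` whose Fourier transform (with kernel
`e^{-2πizt}`) vanishes almost everywhere outside `[-R, R]`. -/
def paleyWiener (R : ℝ) : Set SignalSpace :=
  {s | ∀ᵐ z : ℝ, z ∉ Set.Icc (-R) R → (𝓕 s : SignalSpace) z = 0}

/-- Time-limited signals of resolution `M`: signals vanishing outside `(-M/(2R), M/(2R))` and given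
inside by a Fourier series `∑_{n=-M}^{M} √(R/M) c_n e^{2πi n (R/M) t}`. -/
def timeLimitedFourier (R : ℝ) (M : ℕ) : Set SignalSpace :=
  {q | ∃ c : ℤ → ℂ, q =ᵐ[volume]
    (Set.Ioo (-(M / (2 * R))) (M / (2 * R))).indicator (fun t : ℝ =>
      ∑ n ∈ Finset.Icc (-(M : ℤ)) (M : ℤ),
        (Real.sqrt (R / M) : ℂ) * c n *
          Complex.exp (2 * Real.pi * Complex.I * n * ((R / M : ℝ) : ℂ) * t))}

/-- The phase space domain: `|ω| < W R` and `|x| < M/(2R) + τ₂/a_τ`, for `τ ∈ [τ₁, τ₂]`. -/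
def ltftDomain {τ₁ τ₂ : ℝ} (a : Set.Icc τ₁ τ₂ → ℝ) (R W : ℝ) (M : ℕ) :
    Set (LTFTPhaseSpace τ₁ τ₂) :=
  {g | |g.2.1| < W * R ∧ |g.1| < M / (2 * R) + τ₂ / a g.2.2}

/-- The envelope: the indicator function of the phase space domain. -/
def ltftEnvelope {τ₁ τ₂ : ℝ} (a : Set.Icc τ₁ τ₂ → ℝ) (R W : ℝ) (M : ℕ) :
    LTFTPhaseSpace τ₁ τ₂ → ℝ :=
  (ltftDomain a R W M).indicator 1

end

/-!
The proof computes everything on the frequency side. Write `ĥ` for the Fourier transform of the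
window, which is continuous, bounded and square integrable. The atom with parameters `(x, ω, τ)` has
Fourier transform `e^{-2πixz} K(z, ω, τ)` with `K = |σ|^{1/2} ĥ(σ (z - ω))`, so for fixed `(ω, τ)`
the coefficient function is, as a function of `x`, the inverse Fourier transform of `conj K · ŝ`.
Plancherel's theorem and Tonelli's theorem give, for every s-finite measure `ν` in `(ω, τ)`,
`∫∫ |V_f[s]|² dx dν = ∫ |ŝ(z)|² (∫ |K(z, p)|² dν(p)) dz` (`IsLTFTData.lintegral_coeffFun_sq`), and
the claims about the frame become bounds for the inner integral `∫ |K|² dν`.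

* Frame bounds. At low frequencies `|K|²` is bounded and `ω` ranges over a bounded set; at high
  frequencies `σ = τ / b_τ` is constant in `ω` and a substitution gives at most `‖ĥ‖²`. For the
  lower bound, `ĥ` stays away from `0` near the origin since `h ≥ 0` is not zero. As
  `|σ| = τ / m(ω)`, where `m` truncates `|ω|` to `[a_τ, b_τ]`, an interval of `ω` of length
  comparable to `m(z)`, starting at `z` and leading away from the origin, contributes an amount
  that depends on `h` and `τ₁` only (`IsLTFTData.lintegral_atomSpectrum_ge`).
* Envelopes. A signal in `V_M` and the atoms have bounded supports, so `V_f[s]` vanishes for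
  `|x| ≥ M/(2R) + τ₂/a_τ`, and the error comes from `|ω| ≥ W R` alone. If `|z| ≤ l R`, then
  `|σ (z - ω)| ≥ τ₁ (W - l)` there, and only the tail of `ĥ` contributes. The remaining
  frequencies `|z| ≥ l R` carry a fraction of the energy of `s ∈ V_M` that is small for large `l`
  uniformly in `M` and `R`, by the decay of the `2 M + 1` Fourier transforms of the basis of `V_M`
  (`setLIntegral_fourier_le_of_mem_timeLimitedFourier`). Compared with the uniform lower frame
  bound this yields a threshold for `W` that depends only on `ε`, `h` and `τ₁`.
* Discretization. The spanning exponentials of `V_M` are orthonormal, so the dimension is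
  `2 M + 1`. Let `ŝ` be a continuous function `F` cut off to `[-R, R]`. The element of `V_M` with
  coefficients `√(R/M) F(n R / M)` is a Riemann sum of the Fourier integral of `s`, hence converges
  to `s` pointwise, while its squared norm is a Riemann sum of `∫ |F|²`, hence converges to `‖s‖²`;
  together these give convergence in `L²`. Such signals are dense in the Paley--Wiener space, and
  orthogonal projections onto `V_M` handle the general case.
-/

noncomputable section

/-! ### The Fourier transform on `L¹ ∩ L²` -/

/-- Schwartz functions separate locally integrable functions. -/
theorem ae_eq_of_forall_integral_schwartz_mul_eq {f g : ℝ → ℂ} (hf : LocallyIntegrable f)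
    (hg : LocallyIntegrable g)
    (hfg : ∀ φ : SchwartzMap ℝ ℂ, ∫ x, φ x * f x = ∫ x, φ x * g x) : f =ᵐ[volume] g := by
  refine ae_eq_of_integral_contDiff_smul_eq hf hg fun u hu hc => ?_
  have hu' : ContDiff ℝ (⊤ : ℕ∞) (fun x => (u x : ℂ)) := Complex.ofRealCLM.contDiff.comp hu
  have hc' : HasCompactSupport (fun x => (u x : ℂ)) := hc.comp_left Complex.ofReal_zero
  simpa [Complex.real_smul] using hfg (hc'.toSchwartzMap hu')

/-- On `L¹ ∩ L²` the `L²` Fourier transform is the Fourier integral: both have the same pairings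
with Schwartz functions. -/
theorem fourier_toLp_ae_eq {f : ℝ → ℂ} (h1 : Integrable f) (h2 : MemLp f 2 volume) :
    (𝓕 (h2.toLp f) : SignalSpace) =ᵐ[volume] 𝓕 f := by
  refine ae_eq_of_forall_integral_schwartz_mul_eq
    ((Lp.memLp _).locallyIntegrable (by norm_num)) ?_ fun φ => ?_
  · exact (VectorFourier.fourierIntegral_continuous Real.continuous_fourierChar
      (by fun_prop) h1).locallyIntegrable
  · have e1 := congrArg (fun T => T φ) (Lp.fourier_toTemperedDistribution_eq (h2.toLp f))
    simp only [TemperedDistribution.fourier_apply, Lp.toTemperedDistribution_apply,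
      smul_eq_mul] at e1
    rw [← e1]
    have e2 := VectorFourier.integral_fourierIntegral_smul_eq_flip (μ := volume) (ν := volume)
      (L := innerₗ ℝ) (f := (φ : ℝ → ℂ)) (g := f) Real.continuous_fourierChar
      (by fun_prop) φ.integrable h1
    have e3 : ∀ g : ℝ → ℂ, VectorFourier.fourierIntegral Real.fourierChar volume
      (innerₗ ℝ).flip g = 𝓕 g := by
      intro g; rw [flip_innerₗ]; rfl
    rw [e3] at e2
    refine Eq.trans (integral_congr_ae ?_) e2
    filter_upwards [h2.coeFn_toLp] with x hx
    rw [hx, SchwartzMap.fourier_coe]; rfl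

theorem fourierInv_toLp_ae_eq {f : ℝ → ℂ} (h1 : Integrable f) (h2 : MemLp f 2 volume) :
    (𝓕⁻ (h2.toLp f) : SignalSpace) =ᵐ[volume] 𝓕⁻ f := by
  have h1' : Integrable (fun x => f (-x)) := h1.comp_neg
  have h2' : MemLp (fun x => f (-x)) 2 volume :=
    h2.comp_measurePreserving (Measure.measurePreserving_neg volume)
  rw [Real.fourierInv_eq_fourier_comp_neg]
  refine ae_eq_of_forall_integral_schwartz_mul_eq
    ((Lp.memLp _).locallyIntegrable (by norm_num)) ?_ fun φ => ?_
  · exact (VectorFourier.fourierIntegral_continuous Real.continuous_fourierChar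
      (by fun_prop) h1').locallyIntegrable
  · have e1 := congrArg (fun T => T φ) (Lp.fourierInv_toTemperedDistribution_eq (h2.toLp f))
    simp only [TemperedDistribution.fourierInv_apply, Lp.toTemperedDistribution_apply,
      smul_eq_mul] at e1
    rw [← e1]
    have e2 := VectorFourier.integral_fourierIntegral_smul_eq_flip (μ := volume) (ν := volume)
      (L := innerₗ ℝ) (f := (φ : ℝ → ℂ)) (g := fun x => f (-x)) Real.continuous_fourierChar
      (by fun_prop) φ.integrable h1'
    have e3 : ∀ g : ℝ → ℂ, VectorFourier.fourierIntegral Real.fourierChar volume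
      (innerₗ ℝ).flip g = 𝓕 g := by
      intro g; rw [flip_innerₗ]; rfl
    rw [e3] at e2
    refine Eq.trans ?_ e2
    rw [← integral_neg_eq_self]
    refine integral_congr_ae ?_
    filter_upwards [(Measure.measurePreserving_neg volume).quasiMeasurePreserving.ae
      h2.coeFn_toLp] with x hx
    rw [hx, SchwartzMap.fourierInv_coe, Real.fourierInv_eq_fourier_neg, neg_neg]; rfl

theorem eLpNorm_two_sq {α : Type*} [MeasurableSpace α] (μ : Measure α) (f : α → ℂ) :
    eLpNorm f 2 μ ^ 2 = ∫⁻ x, ‖f x‖ₑ ^ 2 ∂μ := by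
  have := eLpNorm_nnreal_pow_eq_lintegral (f := f) (μ := μ) (p := 2) (by norm_num)
  simpa only [NNReal.coe_ofNat, ENNReal.rpow_ofNat, ENNReal.coe_ofNat] using this

theorem lintegral_enorm_sq_eq (s : SignalSpace) : ∫⁻ x, ‖s x‖ₑ ^ 2 = ‖s‖ₑ ^ 2 := by
  rw [Lp.enorm_def, eLpNorm_two_sq]

theorem lintegral_enorm_sq_fourier_eq (s : SignalSpace) :
    ∫⁻ z, ‖(𝓕 s : SignalSpace) z‖ₑ ^ 2 = ‖s‖ₑ ^ 2 := by
  rw [lintegral_enorm_sq_eq, ← ofReal_norm, ← ofReal_norm, Lp.norm_fourier_eq]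

theorem lintegral_enorm_sq_fourierInv {f : ℝ → ℂ} (h1 : Integrable f) (h2 : MemLp f 2 volume) :
    ∫⁻ x, ‖𝓕⁻ f x‖ₑ ^ 2 = ∫⁻ x, ‖f x‖ₑ ^ 2 := by
  have e : ‖(𝓕⁻ (h2.toLp f) : SignalSpace)‖ₑ = ‖h2.toLp f‖ₑ := by
    have := (Lp.fourierTransformₗᵢ ℝ ℂ).symm.enorm_map (h2.toLp f)
    exact this
  have a1 := lintegral_enorm_sq_eq (𝓕⁻ (h2.toLp f) : SignalSpace)
  have a2 := lintegral_enorm_sq_eq (h2.toLp f)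
  rw [e, ← a2] at a1
  rw [lintegral_congr_ae (g := fun x => ‖(𝓕⁻ (h2.toLp f) : SignalSpace) x‖ₑ ^ 2), a1]
  · refine lintegral_congr_ae ?_
    filter_upwards [h2.coeFn_toLp] with x hx
    rw [hx]
  · filter_upwards [fourierInv_toLp_ae_eq h1 h2] with x hx
    rw [hx]

theorem lintegral_enorm_sq_fourier {f : ℝ → ℂ} (h1 : Integrable f) (h2 : MemLp f 2 volume) :
    ∫⁻ x, ‖𝓕 f x‖ₑ ^ 2 = ∫⁻ x, ‖f x‖ₑ ^ 2 := by
  rw [← lintegral_enorm_sq_fourierInv h1 h2]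
  simp_rw [Real.fourierInv_eq_fourier_neg]
  exact ((Measure.measurePreserving_neg volume).lintegral_comp_emb
    (MeasurableEquiv.neg ℝ).measurableEmbedding (fun x => ‖𝓕 f x‖ₑ ^ 2)).symm

/-! ### Coefficient functions of the LTFT on the frequency side -/

/-- The Fourier transform of the window, as an integral, hence defined at every point. -/
def windowFourier (h : ℝ → ℝ) : ℝ → ℂ := 𝓕 (fun t => (h t : ℂ))

theorem integrable_window {h : ℝ → ℝ} (h_supp : Function.support h ⊆ Set.Icc (-1 / 2) (1 / 2))
    (h_memLp : MemLp h 2 volume) : Integrable (fun t => (h t : ℂ)) := by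
  refine Integrable.ofReal ?_
  rw [← integrableOn_iff_integrable_of_support_subset h_supp]
  exact (h_memLp.restrict _).integrable (by norm_num)

theorem continuous_windowFourier {h : ℝ → ℝ} (h1 : Integrable (fun t => (h t : ℂ))) :
    Continuous (windowFourier h) :=
  VectorFourier.fourierIntegral_continuous Real.continuous_fourierChar (by fun_prop) h1

theorem norm_windowFourier_le (h : ℝ → ℝ) (u : ℝ) :
    ‖windowFourier h u‖ ≤ ∫ t, ‖(h t : ℂ)‖ :=
  VectorFourier.norm_fourierIntegral_le_integral_norm _ _ _ _ _

/-- The Fourier transform at `z` of the atom with parameters `p = (ω, τ)` and time `0`. -/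
def atomSpectrum {τ₁ τ₂ : ℝ} (h : ℝ → ℝ) (a b : Set.Icc τ₁ τ₂ → ℝ) (z : ℝ)
    (p : ℝ × Set.Icc τ₁ τ₂) : ℂ :=
  (Real.sqrt |ltftScale (a p.2) (b p.2) p.1 p.2| : ℝ) *
    windowFourier h (ltftScale (a p.2) (b p.2) p.1 p.2 * (z - p.1))

theorem fourier_ltftAtomFun {τ₁ τ₂ : ℝ} (h : ℝ → ℝ) (a b : Set.Icc τ₁ τ₂ → ℝ) (x z : ℝ)
    (p : ℝ × Set.Icc τ₁ τ₂) (hσ : ltftScale (a p.2) (b p.2) p.1 p.2 ≠ 0) :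
    𝓕 (ltftAtomFun h a b (x, p)) z =
      Complex.exp (-(2 * Real.pi * Complex.I * x * z)) * atomSpectrum h a b z p := by
  obtain ⟨ω, τ⟩ := p
  simp only [atomSpectrum, windowFourier] at hσ ⊢
  set σ := ltftScale (a τ) (b τ) ω τ with hs
  rw [Real.fourier_real_eq_integral_exp_smul, Real.fourier_real_eq_integral_exp_smul]
  simp only [ltftAtomFun_apply, ← hs, smul_eq_mul]
  set g : ℝ → ℂ := fun v => Complex.exp (-(2 * Real.pi * Complex.I * x * z)) *
    ((Real.sqrt |σ|)⁻¹ : ℝ) *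
    (Complex.exp (↑(-2 * Real.pi * v * (σ * (z - ω))) * Complex.I) * (h v : ℂ)) with hg
  have e1 : ∀ t : ℝ, Complex.exp (↑(-2 * Real.pi * t * z) * Complex.I) *
      (((Real.sqrt |σ|)⁻¹ : ℝ) * (h (σ⁻¹ * (t - x)) : ℂ) *
        Complex.exp (2 * Real.pi * Complex.I * ω * ((t - x : ℝ) : ℂ))) = g (σ⁻¹ * (t - x)) := by
    intro t
    have : Complex.exp (↑(-2 * Real.pi * t * z) * Complex.I) *
        Complex.exp (2 * Real.pi * Complex.I * ω * ((t - x : ℝ) : ℂ)) =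
      Complex.exp (-(2 * Real.pi * Complex.I * x * z)) *
        Complex.exp (↑(-2 * Real.pi * (σ⁻¹ * (t - x)) * (σ * (z - ω))) * Complex.I) := by
      rw [← Complex.exp_add, ← Complex.exp_add]
      congr 1
      have : -2 * Real.pi * (σ⁻¹ * (t - x)) * (σ * (z - ω)) =
          -2 * Real.pi * ((t - x) * (z - ω)) := by field_simp
      rw [this]
      push_cast
      ring
    simp only [hg]
    linear_combination (((Real.sqrt |σ|)⁻¹ : ℝ) * (h (σ⁻¹ * (t - x)) : ℂ)) * this
  simp_rw [e1]
  rw [integral_sub_right_eq_self (fun t => g (σ⁻¹ * t)) x, Measure.integral_comp_mul_left, inv_inv,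
    hg, integral_const_mul, Complex.real_smul]
  have e2 : (|σ| : ℝ) * (Real.sqrt |σ|)⁻¹ = Real.sqrt |σ| := by
    rw [← div_eq_mul_inv, Real.div_sqrt]
  have e3 : (((|σ| : ℝ)) : ℂ) * ((Real.sqrt |σ|)⁻¹ : ℝ) = (Real.sqrt |σ| : ℝ) := by
    exact_mod_cast e2
  rw [← e3]
  ring

theorem integrable_ltftAtomFun {τ₁ τ₂ : ℝ} {h : ℝ → ℝ} (h1 : Integrable (fun t => (h t : ℂ)))
    (a b : Set.Icc τ₁ τ₂ → ℝ) (x : ℝ)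
    (p : ℝ × Set.Icc τ₁ τ₂) (hσ : ltftScale (a p.2) (b p.2) p.1 p.2 ≠ 0) :
    Integrable (ltftAtomFun h a b (x, p)) := by
  obtain ⟨ω, τ⟩ := p
  have e := ((h1.comp_mul_left' (inv_ne_zero hσ)).comp_sub_right x).const_mul
    (((Real.sqrt |ltftScale (a τ) (b τ) ω τ|)⁻¹ : ℝ) : ℂ)
  refine Integrable.mono e ?_ (ae_of_all _ fun t => ?_)
  · exact e.1.mul (Continuous.aestronglyMeasurable (by fun_prop))
  · have : ‖Complex.exp (2 * Real.pi * Complex.I * ω * ((t - x : ℝ) : ℂ))‖ = 1 := by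
      rw [show (2 * Real.pi * Complex.I * ω * ((t - x : ℝ) : ℂ) : ℂ)
        = ((2 * Real.pi * ω * (t - x) : ℝ) : ℂ) * Complex.I by push_cast; ring]
      exact Complex.norm_exp_ofReal_mul_I _
    rw [ltftAtomFun_apply, norm_mul, this, mul_one]

theorem measurable_ltftScale {τ₁ τ₂ : ℝ} {a b : Set.Icc τ₁ τ₂ → ℝ} (ha : Measurable a)
    (hb : Measurable b) :
    Measurable (fun p : ℝ × Set.Icc τ₁ τ₂ => ltftScale (a p.2) (b p.2) p.1 p.2) := by
  unfold ltftScale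
  refine Measurable.ite (measurableSet_lt (by fun_prop) (by fun_prop)) (by fun_prop) ?_
  exact Measurable.ite (measurableSet_le (by fun_prop) (by fun_prop)) (by fun_prop) (by fun_prop)

theorem measurable_atomSpectrum {τ₁ τ₂ : ℝ} {h : ℝ → ℝ} (h1 : Integrable (fun t => (h t : ℂ)))
    {a b : Set.Icc τ₁ τ₂ → ℝ} (ha : Measurable a) (hb : Measurable b) :
    Measurable (fun q : ℝ × (ℝ × Set.Icc τ₁ τ₂) => atomSpectrum h a b q.1 q.2) := by
  have hσ := (measurable_ltftScale ha hb).comp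
    (measurable_snd : Measurable (Prod.snd : ℝ × (ℝ × Set.Icc τ₁ τ₂) → _))
  have hc := (continuous_windowFourier h1).measurable
  unfold atomSpectrum
  refine Measurable.mul ?_ (hc.comp (hσ.mul (by fun_prop)))
  exact Complex.measurable_ofReal.comp (Real.continuous_sqrt.measurable.comp
    (measurable_norm.comp hσ))

/-- Standing assumptions on the window and the transition frequencies. Of the compact support of
the window only its integrability is recorded. -/
structure IsLTFTData {τ₁ τ₂ : ℝ} (h : ℝ → ℝ) (a b : Set.Icc τ₁ τ₂ → ℝ) : Prop where
  integrable : Integrable (fun t => (h t : ℂ))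
  memLp : MemLp h 2 volume
  pos_left : 0 < τ₁
  pos_a : ∀ τ, 0 < a τ
  a_lt_b : ∀ τ, a τ < b τ
  measurable_a : Measurable a
  measurable_b : Measurable b

namespace IsLTFTData

variable {τ₁ τ₂ : ℝ} {h : ℝ → ℝ} {a b : Set.Icc τ₁ τ₂ → ℝ}

theorem pos_b (D : IsLTFTData h a b) (τ) : 0 < b τ := (D.pos_a τ).trans (D.a_lt_b τ)

theorem scale_ne_zero (D : IsLTFTData h a b) (p : ℝ × Set.Icc τ₁ τ₂) :
    ltftScale (a p.2) (b p.2) p.1 p.2 ≠ 0 :=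
  ltftScale_ne_zero (D.pos_a _) (D.pos_b _) (D.pos_left.trans_le p.2.2.1)

theorem memLp_atomFun (D : IsLTFTData h a b) (g : LTFTPhaseSpace τ₁ τ₂) :
    MemLp (ltftAtomFun h a b g) 2 volume :=
  memLp_ltftAtomFun D.pos_left D.memLp D.pos_a D.pos_b g

theorem ltftAtom_eq (D : IsLTFTData h a b) (g : LTFTPhaseSpace τ₁ τ₂) :
    ltftAtom h a b g = (D.memLp_atomFun g).toLp _ := dif_pos _

theorem fourier_ltftAtom (D : IsLTFTData h a b) (x : ℝ) (p : ℝ × Set.Icc τ₁ τ₂) :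
    (𝓕 (ltftAtom h a b (x, p)) : SignalSpace) =ᵐ[volume] fun z =>
      Complex.exp (-(2 * Real.pi * Complex.I * x * z)) * atomSpectrum h a b z p := by
  rw [D.ltftAtom_eq]
  filter_upwards [fourier_toLp_ae_eq (integrable_ltftAtomFun D.integrable a b x p
    (D.scale_ne_zero p)) (D.memLp_atomFun (x, p))] with z hz
  rw [hz, fourier_ltftAtomFun _ _ _ _ _ _ (D.scale_ne_zero p)]

/-- The integrand is jointly measurable in `z` and the phase space point, even if the window is
measurable only up to a null set. -/
theorem coeffFun_eq_integral (D : IsLTFTData h a b) (s : SignalSpace) (x : ℝ)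
    (p : ℝ × Set.Icc τ₁ τ₂) :
    coeffFun (ltftAtom h a b) s (x, p) =
      ∫ z : ℝ, Complex.exp (2 * Real.pi * Complex.I * x * z) *
        (starRingEnd ℂ (atomSpectrum h a b z p) * (𝓕 s : SignalSpace) z) := by
  rw [coeffFun, ← Lp.inner_fourier_eq, L2.inner_def]
  refine integral_congr_ae ?_
  filter_upwards [D.fourier_ltftAtom x p] with z hz
  rw [hz, RCLike.inner_apply, map_mul, ← Complex.exp_conj]
  have : starRingEnd ℂ (-(2 * Real.pi * Complex.I * x * z)) = 2 * Real.pi * Complex.I * x * z := by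
    simp [map_ofNat (starRingEnd ℂ) 2]
  rw [this]
  ring

theorem integrable_spectrum_mul (D : IsLTFTData h a b) (s : SignalSpace)
    (p : ℝ × Set.Icc τ₁ τ₂) :
    Integrable (fun z => starRingEnd ℂ (atomSpectrum h a b z p) * (𝓕 s : SignalSpace) z) := by
  refine (L2.integrable_inner (𝕜 := ℂ) (𝓕 (ltftAtom h a b (0, p)) : SignalSpace)
    (𝓕 s : SignalSpace)).congr ?_
  filter_upwards [D.fourier_ltftAtom 0 p] with z hz
  rw [hz, RCLike.inner_apply]
  simp [mul_comm]

theorem memLp_spectrum_mul (D : IsLTFTData h a b) (s : SignalSpace)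
    (p : ℝ × Set.Icc τ₁ τ₂) :
    MemLp (fun z => starRingEnd ℂ (atomSpectrum h a b z p) * (𝓕 s : SignalSpace) z) 2 volume := by
  refine MemLp.of_le_mul (c := Real.sqrt |ltftScale (a p.2) (b p.2) p.1 p.2| *
    ∫ t, ‖(h t : ℂ)‖) (Lp.memLp (𝓕 s : SignalSpace)) (D.integrable_spectrum_mul s p).1
    (ae_of_all _ fun z => ?_)
  rw [norm_mul, RCLike.norm_conj, atomSpectrum, norm_mul, Complex.norm_real, Real.norm_of_nonneg
    (Real.sqrt_nonneg _)]
  gcongr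
  exact norm_windowFourier_le _ _

theorem coeffFun_eq_fourierInv (D : IsLTFTData h a b) (s : SignalSpace) (x : ℝ)
    (p : ℝ × Set.Icc τ₁ τ₂) :
    coeffFun (ltftAtom h a b) s (x, p) =
      𝓕⁻ (fun z => starRingEnd ℂ (atomSpectrum h a b z p) * (𝓕 s : SignalSpace) z) x := by
  rw [D.coeffFun_eq_integral, Real.fourierInv_eq']
  refine integral_congr_ae (ae_of_all _ fun z => ?_)
  simp only [smul_eq_mul]
  congr 2
  simp only [RCLike.inner_apply, conj_trivial]
  push_cast
  ring

theorem measurable_coeffFun (D : IsLTFTData h a b) (s : SignalSpace) :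
    Measurable (coeffFun (ltftAtom h a b) s) := by
  have e : coeffFun (ltftAtom h a b) s = fun g => ∫ z : ℝ,
      Complex.exp (2 * Real.pi * Complex.I * g.1 * z) *
        (starRingEnd ℂ (atomSpectrum h a b z g.2) * (𝓕 s : SignalSpace) z) := by
    funext g
    exact D.coeffFun_eq_integral s g.1 g.2
  rw [e]
  refine StronglyMeasurable.measurable (StronglyMeasurable.integral_prod_right'
    (f := fun q : LTFTPhaseSpace τ₁ τ₂ × ℝ => Complex.exp (2 * Real.pi * Complex.I * q.1.1 * q.2) *
        (starRingEnd ℂ (atomSpectrum h a b q.2 q.1.2) * (𝓕 s : SignalSpace) q.2)) ?_)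
  refine Measurable.stronglyMeasurable ?_
  have h1 := (measurable_atomSpectrum D.integrable D.measurable_a D.measurable_b).comp
    (measurable_snd.prodMk (measurable_snd.comp measurable_fst) :
      Measurable (fun q : LTFTPhaseSpace τ₁ τ₂ × ℝ => (q.2, q.1.2)))
  have h2 : Measurable (𝓕 s : SignalSpace) := (Lp.stronglyMeasurable _).measurable
  refine Measurable.mul ?_ (Measurable.mul ?_ ?_)
  · fun_prop
  · exact (Complex.continuous_conj.measurable).comp h1
  · exact h2.comp measurable_snd

/-- Plancherel's theorem in the time variable and Tonelli's theorem turn the energy of the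
coefficient function into a weighted energy of the Fourier transform of the signal. -/
theorem lintegral_coeffFun_sq (D : IsLTFTData h a b) (s : SignalSpace)
    (ν : Measure (ℝ × Set.Icc τ₁ τ₂)) [SFinite ν] :
    ∫⁻ g, ‖coeffFun (ltftAtom h a b) s g‖ₑ ^ 2 ∂(volume.prod ν) =
      ∫⁻ z, ‖(𝓕 s : SignalSpace) z‖ₑ ^ 2 * ∫⁻ p, ‖atomSpectrum h a b z p‖ₑ ^ 2 ∂ν := by
  have hV := D.measurable_coeffFun s
  have hK := measurable_atomSpectrum D.integrable D.measurable_a D.measurable_b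
  have hS : Measurable (𝓕 s : SignalSpace) := (Lp.stronglyMeasurable _).measurable
  rw [lintegral_prod_symm _ (by fun_prop)]
  calc _ = ∫⁻ p, (∫⁻ z : ℝ, ‖(𝓕 s : SignalSpace) z‖ₑ ^ 2 * ‖atomSpectrum h a b z p‖ₑ ^ 2) ∂ν := by
        refine lintegral_congr fun p => ?_
        simp_rw [D.coeffFun_eq_fourierInv]
        rw [lintegral_enorm_sq_fourierInv (D.integrable_spectrum_mul s p)
          (D.memLp_spectrum_mul s p)]
        refine lintegral_congr fun z => ?_
        rw [enorm_mul, mul_pow, RCLike.enorm_conj, mul_comm]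
    _ = _ := by
        rw [lintegral_lintegral_swap]
        · refine lintegral_congr fun z => ?_
          rw [lintegral_const_mul]
          exact ((hK.comp (measurable_prodMk_left (x := z))).enorm.pow_const 2)
        · refine Measurable.aemeasurable ?_
          exact ((hS.comp measurable_snd).enorm.pow_const 2).mul
            ((hK.comp measurable_swap).enorm.pow_const 2)

end IsLTFTData

/-! ### Bounds for the energy of the spectra of the atoms -/

/-- The scale is `τ` divided by the truncation of `|ω|` to `[α, β]`. -/
theorem abs_ltftScale {α β ω τ : ℝ} (hα : 0 < α) (hαβ : α < β) (hτ : 0 < τ) :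
    |ltftScale α β ω τ| = τ / max α (min |ω| β) := by
  unfold ltftScale
  split_ifs with h1 h2
  · rw [min_eq_left (h1.trans hαβ).le, max_eq_left h1.le, abs_of_pos (by positivity)]
  · rw [min_eq_left h2, max_eq_right (not_lt.1 h1), abs_div, abs_of_pos hτ]
  · rw [min_eq_right (not_le.1 h2).le, max_eq_right hαβ.le,
      abs_of_pos (div_pos hτ (hα.trans hαβ))]

theorem enorm_atomSpectrum_sq {τ₁ τ₂ : ℝ} (h : ℝ → ℝ) (a b : Set.Icc τ₁ τ₂ → ℝ) (z : ℝ)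
    (p : ℝ × Set.Icc τ₁ τ₂) :
    ‖atomSpectrum h a b z p‖ₑ ^ 2 = ENNReal.ofReal |ltftScale (a p.2) (b p.2) p.1 p.2| *
      ‖windowFourier h (ltftScale (a p.2) (b p.2) p.1 p.2 * (z - p.1))‖ₑ ^ 2 := by
  rw [atomSpectrum, enorm_mul, mul_pow, ← ofReal_norm, Complex.norm_real,
    Real.norm_of_nonneg (Real.sqrt_nonneg _), ← ENNReal.ofReal_pow (Real.sqrt_nonneg _),
    Real.sq_sqrt (abs_nonneg _)]

theorem lintegral_ofReal_mul_comp_mul_sub {c : ℝ} (hc : 0 < c) (z : ℝ) {f : ℝ → ℝ≥0∞}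
    (hf : Measurable f) :
    ∫⁻ ω, ENNReal.ofReal c * f (c * (z - ω)) = ∫⁻ u, f u := by
  rw [lintegral_const_mul _ (by fun_prop), lintegral_sub_left_eq_self (fun w => f (c * w)) z]
  have e1 : ∫⁻ w, f (c * w) = ∫⁻ u, f u ∂(Measure.map (c * ·) volume) :=
    (lintegral_map hf (by fun_prop)).symm
  rw [e1, Real.map_volume_mul_left hc.ne', lintegral_smul_measure, smul_eq_mul, ← mul_assoc,
    ← ENNReal.ofReal_mul hc.le, abs_of_pos (by positivity), mul_inv_cancel₀ hc.ne']
  simp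

/-- The energy of the frequency response of the window outside `(-r, r)`. -/
def windowTail (h : ℝ → ℝ) (r : ℝ) : ℝ≥0∞ :=
  ∫⁻ u in {u : ℝ | r ≤ |u|}, ‖windowFourier h u‖ₑ ^ 2

theorem measurableSet_le_abs (r : ℝ) : MeasurableSet {u : ℝ | r ≤ |u|} :=
  measurableSet_le measurable_const measurable_norm

theorem lintegral_windowFourier_sq_lt_top {h : ℝ → ℝ} (h1 : Integrable (fun t => (h t : ℂ)))
    (h2 : MemLp h 2 volume) : ∫⁻ u, ‖windowFourier h u‖ₑ ^ 2 < ∞ := by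
  have h2' : MemLp (fun t => (h t : ℂ)) 2 volume := h2.ofReal
  rw [windowFourier, lintegral_enorm_sq_fourier h1 h2', ← eLpNorm_two_sq]
  exact ENNReal.pow_lt_top h2'.2

theorem tendsto_setLIntegral_le_abs {f : ℝ → ℝ≥0∞} (hf : Measurable f)
    (hfi : ∫⁻ u, f u ≠ ∞) : Tendsto (fun r => ∫⁻ u in {u : ℝ | r ≤ |u|}, f u) atTop (𝓝 0) := by
  simp_rw [← lintegral_indicator (measurableSet_le_abs _)]
  rw [← lintegral_zero (μ := (volume : Measure ℝ))]
  refine tendsto_lintegral_filter_of_dominated_convergence _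
    (.of_forall fun r => hf.indicator (measurableSet_le_abs r))
    (.of_forall fun r => ae_of_all _ fun u => Set.indicator_le_self _ _ u)
    hfi (ae_of_all _ fun u => ?_)
  refine tendsto_const_nhds.congr' ?_
  filter_upwards [eventually_gt_atTop |u|] with r hr
  rw [Set.indicator_of_notMem]
  simpa using hr

theorem tendsto_windowTail {h : ℝ → ℝ} (h1 : Integrable (fun t => (h t : ℂ)))
    (h2 : MemLp h 2 volume) : Tendsto (windowTail h) atTop (𝓝 0) :=
  tendsto_setLIntegral_le_abs ((continuous_windowFourier h1).measurable.enorm.pow_const 2)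
    (lintegral_windowFourier_sq_lt_top h1 h2).ne

theorem windowFourier_zero_ne {h : ℝ → ℝ} (h0 : ∀ t, 0 ≤ h t)
    (h1 : Integrable (fun t => (h t : ℂ))) (h_ne : ¬ h =ᵐ[volume] 0) :
    windowFourier h 0 ≠ 0 := by
  have : windowFourier h 0 = ((∫ t, h t : ℝ) : ℂ) := by
    rw [windowFourier, Real.fourier_real_eq_integral_exp_smul, ← integral_complex_ofReal]
    simp
  rw [this, Ne, Complex.ofReal_eq_zero, integral_eq_zero_iff_of_nonneg h0]
  · exact h_ne
  · simpa using h1.re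

theorem exists_windowFourier_lower {h : ℝ → ℝ} (h0 : ∀ t, 0 ≤ h t)
    (h1 : Integrable (fun t => (h t : ℂ))) (h_ne : ¬ h =ᵐ[volume] 0) :
    ∃ δ κ : ℝ, 0 < δ ∧ 0 < κ ∧ ∀ u, |u| ≤ δ → κ ≤ ‖windowFourier h u‖ := by
  have hp : 0 < ‖windowFourier h 0‖ := norm_pos_iff.2 (windowFourier_zero_ne h0 h1 h_ne)
  have hc := (continuous_windowFourier h1).norm.continuousAt.eventually
    (lt_mem_nhds (half_lt_self hp))
  obtain ⟨δ, hδ, hs⟩ := Metric.nhds_basis_closedBall.eventually_iff.1 hc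
  exact ⟨δ, _, hδ, half_pos hp, fun u hu => (hs (by simpa using hu)).le⟩

namespace IsLTFTData

variable {τ₁ τ₂ : ℝ} {h : ℝ → ℝ} {a b : Set.Icc τ₁ τ₂ → ℝ}

/-- The lower frame bound. The constant depends on the window and `τ₁` only, not on `a`, `b` or
`μ₃`, which is what makes the threshold for the envelopes uniform. -/
theorem lintegral_atomSpectrum_ge (D : IsLTFTData h a b) (μ₃ : Measure (Set.Icc τ₁ τ₂))
    [IsProbabilityMeasure μ₃] {δ κ : ℝ} (hδ : 0 < δ) (hκ : 0 < κ)
    (hh : ∀ u, |u| ≤ δ → κ ≤ ‖windowFourier h u‖) (z : ℝ) :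
    ENNReal.ofReal (κ ^ 2 * (δ / (1 + δ / τ₁))) ≤
      ∫⁻ p, ‖atomSpectrum h a b z p‖ₑ ^ 2 ∂(volume.prod μ₃) := by
  have hK := (measurable_atomSpectrum D.integrable D.measurable_a D.measurable_b).comp
    (measurable_prodMk_left (x := z))
  rw [lintegral_prod_symm _ (by exact (hK.enorm.pow_const 2).aemeasurable)]
  have key : ∀ τ : Set.Icc τ₁ τ₂, ENNReal.ofReal (κ ^ 2 * (δ / (1 + δ / τ₁))) ≤
      ∫⁻ ω, ‖atomSpectrum h a b z (ω, τ)‖ₑ ^ 2 := by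
    intro τ
    have hτ1 := D.pos_left
    have hτ : (0 : ℝ) < τ := hτ1.trans_le τ.2.1
    have hα := D.pos_a τ
    have hαβ := D.a_lt_b τ
    set m : ℝ := max (a τ) (min |z| (b τ)) with hm
    have hm0 : 0 < m := lt_max_of_lt_left hα
    -- moving away from the origin decreases `|σ|`, but at most by the factor `1 + δ / τ`
    have hlow : ∀ ω, |z| ≤ |ω| → |z - ω| ≤ δ * m / τ →
        ENNReal.ofReal (τ / (m * (1 + δ / τ)) * κ ^ 2) ≤
          ‖atomSpectrum h a b z (ω, τ)‖ₑ ^ 2 := by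
      intro ω hω hd
      have hσ := abs_ltftScale (ω := ω) hα hαβ hτ
      set m' : ℝ := max (a τ) (min |ω| (b τ)) with hm'
      have hmm : m ≤ m' := max_le_max le_rfl (min_le_min_right _ hω)
      have hm'0 : 0 < m' := hm0.trans_le hmm
      have hmu : m' ≤ m * (1 + δ / τ) := by
        have h3 : |ω| ≤ |z| + |z - ω| := by
          have := abs_sub_abs_le_abs_sub ω z
          rw [abs_sub_comm] at this
          linarith
        have h4 : m' ≤ m + |z - ω| := by
          refine max_le ((le_max_left _ _).trans (le_add_of_nonneg_right (abs_nonneg _))) ?_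
          rcases le_total |z| (b τ) with h5 | h5
          · refine (min_le_left _ _).trans (h3.trans ?_)
            gcongr
            exact (le_of_eq (min_eq_left h5).symm).trans (le_max_right _ _)
          · refine (min_le_right _ _).trans ?_
            refine le_add_of_le_of_nonneg ?_ (abs_nonneg _)
            exact (le_of_eq (min_eq_right h5).symm).trans (le_max_right _ _)
        refine h4.trans ?_
        have : m * (1 + δ / τ) = m + δ * m / τ := by ring
        rw [this]
        gcongr
      have hu : |ltftScale (a τ) (b τ) ω τ * (z - ω)| ≤ δ := by
        rw [abs_mul, hσ]
        calc (τ : ℝ) / m' * |z - ω| ≤ τ / m * (δ * m / τ) := by gcongr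
          _ = δ := by field_simp
      rw [enorm_atomSpectrum_sq]
      simp only
      rw [hσ, ← ofReal_norm (windowFourier h _), ← ENNReal.ofReal_pow (norm_nonneg _),
        ← ENNReal.ofReal_mul (by positivity)]
      refine ENNReal.ofReal_le_ofReal ?_
      gcongr
      exact hh _ hu
    -- an interval of length `δ * m / τ` that starts at `z` and leads away from the origin
    obtain ⟨S, hS, hvol, hSz⟩ : ∃ S : Set ℝ, MeasurableSet S ∧
        volume S = ENNReal.ofReal (δ * m / τ) ∧ ∀ ω ∈ S, |z| ≤ |ω| ∧ |z - ω| ≤ δ * m / τ := by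
      have hl : 0 ≤ δ * m / τ := by positivity
      rcases le_total 0 z with hz | hz
      · refine ⟨Set.Icc z (z + δ * m / τ), measurableSet_Icc, by simp, fun ω hω => ⟨?_, ?_⟩⟩
        · rw [abs_of_nonneg hz, abs_of_nonneg (hz.trans hω.1)]; exact hω.1
        · rw [abs_le]; constructor <;> linarith [hω.1, hω.2]
      · refine ⟨Set.Icc (z - δ * m / τ) z, measurableSet_Icc, by simp, fun ω hω => ⟨?_, ?_⟩⟩
        · rw [abs_of_nonpos hz, abs_of_nonpos (hω.2.trans hz)]; linarith [hω.2]
        · rw [abs_le]; constructor <;> linarith [hω.1, hω.2]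
    calc ENNReal.ofReal (κ ^ 2 * (δ / (1 + δ / τ₁)))
        ≤ ENNReal.ofReal (τ / (m * (1 + δ / τ)) * κ ^ 2) * volume S := by
          rw [hvol, ← ENNReal.ofReal_mul (by positivity)]
          refine ENNReal.ofReal_le_ofReal ?_
          have : (τ : ℝ) / (m * (1 + δ / τ)) * κ ^ 2 * (δ * m / τ) = κ ^ 2 * (δ / (1 + δ / τ)) := by
            field_simp
          rw [this]
          gcongr
          exact τ.2.1
      _ = ∫⁻ _ in S, ENNReal.ofReal (τ / (m * (1 + δ / τ)) * κ ^ 2) := by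
          rw [setLIntegral_const]
      _ ≤ ∫⁻ ω in S, ‖atomSpectrum h a b z (ω, τ)‖ₑ ^ 2 :=
          setLIntegral_mono' hS fun ω hω => hlow ω (hSz ω hω).1 (hSz ω hω).2
      _ ≤ _ := setLIntegral_le_lintegral _ _
  calc _ = ∫⁻ _, ENNReal.ofReal (κ ^ 2 * (δ / (1 + δ / τ₁))) ∂μ₃ := by simp
    _ ≤ _ := lintegral_mono key

/-- For `|ω| ≥ W R` the scale is constantly `τ / b τ`, and a substitution bounds the energy by that
of the window response beyond the smallest value `r` of `|σ (z - ω)|`. -/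
theorem setLIntegral_atomSpectrum_le_windowTail (D : IsLTFTData h a b) {R W : ℝ}
    (hb : ∀ τ, b τ < R) (hW : 1 ≤ W) {r z : ℝ} (τ : Set.Icc τ₁ τ₂)
    (hr : ∀ ω, W * R ≤ |ω| → r ≤ τ / b τ * |z - ω|) :
    ∫⁻ ω in {ω : ℝ | W * R ≤ |ω|}, ‖atomSpectrum h a b z (ω, τ)‖ₑ ^ 2 ≤ windowTail h r := by
  have hβ := D.pos_b τ
  have hτ : (0 : ℝ) < τ := D.pos_left.trans_le τ.2.1
  have hc : 0 < τ / b τ := by positivity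
  have hm : Measurable (fun u => ‖windowFourier h u‖ₑ ^ 2) :=
    (continuous_windowFourier D.integrable).measurable.enorm.pow_const 2
  have hm' := hm.indicator (measurableSet_le_abs r)
  rw [windowTail, ← lintegral_indicator (measurableSet_le_abs r),
    ← lintegral_ofReal_mul_comp_mul_sub hc z hm']
  refine (setLIntegral_mono' (measurableSet_le_abs _) fun ω hω => ?_).trans
    (setLIntegral_le_lintegral _ _)
  have hω' : b τ < |ω| := by
    refine lt_of_lt_of_le (hb τ) (le_trans ?_ hω)
    exact le_mul_of_one_le_left (hβ.trans (hb τ)).le hW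
  have hσ : ltftScale (a τ) (b τ) ω τ = τ / b τ := by
    rw [ltftScale, if_neg (not_lt.2 ((D.a_lt_b τ).trans hω').le), if_neg (not_le.2 hω')]
  rw [enorm_atomSpectrum_sq]
  simp only
  rw [hσ, abs_of_pos hc, Set.indicator_of_mem]
  simpa [abs_mul, abs_of_pos hc, abs_of_pos hβ, abs_of_pos hτ] using hr ω hω

theorem lintegral_atomSpectrum_high_le (D : IsLTFTData h a b) (μ₃ : Measure (Set.Icc τ₁ τ₂))
    [IsProbabilityMeasure μ₃] {R W : ℝ} (hb : ∀ τ, b τ < R) (hW : 1 ≤ W) {r z : ℝ}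
    (hr : ∀ τ : Set.Icc τ₁ τ₂, ∀ ω, W * R ≤ |ω| → r ≤ τ / b τ * |z - ω|) :
    ∫⁻ p, ‖atomSpectrum h a b z p‖ₑ ^ 2 ∂((volume.restrict {ω : ℝ | W * R ≤ |ω|}).prod μ₃) ≤
      windowTail h r := by
  have hK := (measurable_atomSpectrum D.integrable D.measurable_a D.measurable_b).comp
    (measurable_prodMk_left (x := z))
  rw [lintegral_prod_symm _ (by exact (hK.enorm.pow_const 2).aemeasurable)]
  calc _ ≤ ∫⁻ _, windowTail h r ∂μ₃ := lintegral_mono fun τ =>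
        D.setLIntegral_atomSpectrum_le_windowTail hb hW τ (hr τ)
    _ = _ := by simp

theorem lintegral_atomSpectrum_high_le_of_abs_le (D : IsLTFTData h a b)
    (μ₃ : Measure (Set.Icc τ₁ τ₂))
    [IsProbabilityMeasure μ₃] {R W l z : ℝ} (hb : ∀ τ, b τ < R) (hW : 1 ≤ W) (hl : l ≤ W)
    (hz : |z| ≤ l * R) :
    ∫⁻ p, ‖atomSpectrum h a b z p‖ₑ ^ 2 ∂((volume.restrict {ω : ℝ | W * R ≤ |ω|}).prod μ₃) ≤
      windowTail h (τ₁ * (W - l)) := by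
  refine D.lintegral_atomSpectrum_high_le μ₃ hb hW fun τ ω hω => ?_
  have hβ := D.pos_b τ
  have hτ : (0 : ℝ) < τ := D.pos_left.trans_le τ.2.1
  have h1 : (W - l) * b τ ≤ |z - ω| := by
    have h2 := abs_sub_abs_le_abs_sub ω z
    rw [abs_sub_comm] at h2
    have h3 : (W - l) * b τ ≤ (W - l) * R :=
      mul_le_mul_of_nonneg_left (hb τ).le (sub_nonneg.2 hl)
    linarith
  calc τ₁ * (W - l) ≤ τ * (W - l) := mul_le_mul_of_nonneg_right τ.2.1 (sub_nonneg.2 hl)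
    _ = τ / b τ * ((W - l) * b τ) := by field_simp
    _ ≤ _ := by gcongr

/-- The upper frame bound: frequencies `|ω| < R` contribute a bounded integrand over a bounded set,
the others at most the energy of the window. -/
theorem exists_lintegral_atomSpectrum_le (D : IsLTFTData h a b) (μ₃ : Measure (Set.Icc τ₁ τ₂))
    [IsProbabilityMeasure μ₃] {R a₀ : ℝ} (hb : ∀ τ, b τ < R) (ha₀ : 0 < a₀) (ha : ∀ τ, a₀ ≤ a τ) :
    ∃ B : ℝ, 0 ≤ B ∧ ∀ z, ∫⁻ p, ‖atomSpectrum h a b z p‖ₑ ^ 2 ∂(volume.prod μ₃) ≤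
      ENNReal.ofReal B := by
  set N := ∫ t, ‖(h t : ℂ)‖
  have hN : 0 ≤ N := integral_nonneg fun _ => norm_nonneg _
  set L : ℝ≥0∞ := ENNReal.ofReal (τ₂ / a₀ * N ^ 2) * volume {ω : ℝ | 1 * R ≤ |ω|}ᶜ + windowTail h 0
  have hL : L ≠ ∞ := by
    refine ENNReal.add_ne_top.2 ⟨ENNReal.mul_ne_top ENNReal.ofReal_ne_top ?_, ?_⟩
    · have : {ω : ℝ | 1 * R ≤ |ω|}ᶜ = Set.Ioo (-R) R := by
        ext ω; simp [abs_lt]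
      rw [this]; simp
    · exact ((setLIntegral_le_lintegral _ _).trans_lt
        (lintegral_windowFourier_sq_lt_top D.integrable D.memLp)).ne
  refine ⟨L.toReal, ENNReal.toReal_nonneg, fun z => ?_⟩
  rw [ENNReal.ofReal_toReal hL]
  have hK := (measurable_atomSpectrum D.integrable D.measurable_a D.measurable_b).comp
    (measurable_prodMk_left (x := z))
  rw [lintegral_prod_symm _ (by exact (hK.enorm.pow_const 2).aemeasurable)]
  have key : ∀ τ : Set.Icc τ₁ τ₂, ∫⁻ ω, ‖atomSpectrum h a b z (ω, τ)‖ₑ ^ 2 ≤ L := by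
    intro τ
    have hτ : (0 : ℝ) < τ := D.pos_left.trans_le τ.2.1
    have hα := D.pos_a τ
    rw [← lintegral_add_compl _ (measurableSet_le_abs (1 * R)), add_comm]
    refine add_le_add ?_ (D.setLIntegral_atomSpectrum_le_windowTail hb le_rfl τ fun ω _ => ?_)
    · rw [← setLIntegral_const]
      refine lintegral_mono fun ω => ?_
      rw [enorm_atomSpectrum_sq]
      simp only
      rw [abs_ltftScale hα (D.a_lt_b τ) hτ, ← ofReal_norm (windowFourier h _),
        ← ENNReal.ofReal_pow (norm_nonneg _), ← ENNReal.ofReal_mul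
          (div_nonneg hτ.le (hα.le.trans (le_max_left _ _)))]
      refine ENNReal.ofReal_le_ofReal ?_
      gcongr
      · have := hτ.le.trans τ.2.2
        positivity
      · exact hτ.le.trans τ.2.2
      · exact τ.2.2
      · exact (ha τ).trans (le_max_left _ _)
      · exact norm_windowFourier_le _ _
    · have := D.pos_b τ
      positivity
  calc _ ≤ ∫⁻ _, L ∂μ₃ := lintegral_mono key
    _ = _ := by simp

end IsLTFTData

/-! ### Time-limited Fourier series -/

/-- The normalized exponential of frequency `n R / M` on `(-M/(2R), M/(2R))`, extended by `0`. -/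
def timeLimitedExp (R : ℝ) (M : ℕ) (n : ℤ) : ℝ → ℂ :=
  (Set.Ioo (-(M / (2 * R))) (M / (2 * R))).indicator (fun t : ℝ =>
    (Real.sqrt (R / M) : ℂ) * Complex.exp (2 * Real.pi * Complex.I * n * ((R / M : ℝ) : ℂ) * t))

theorem norm_cexp_two_pi_mul (x t : ℝ) (n : ℤ) :
    ‖Complex.exp (2 * Real.pi * Complex.I * n * (x : ℂ) * t)‖ = 1 := by
  rw [show (2 * Real.pi * Complex.I * n * (x : ℂ) * t : ℂ)
    = ((2 * Real.pi * n * x * t : ℝ) : ℂ) * Complex.I by push_cast; ring]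
  exact Complex.norm_exp_ofReal_mul_I _

theorem memLp_timeLimitedExp (R : ℝ) (M : ℕ) (n : ℤ) (p : ℝ≥0∞) :
    MemLp (timeLimitedExp R M n) p volume := by
  rw [timeLimitedExp, memLp_indicator_iff_restrict measurableSet_Ioo]
  refine MemLp.of_bound (C := Real.sqrt (R / M))
    (Continuous.aestronglyMeasurable (by fun_prop)) (ae_of_all _ fun t => ?_)
  rw [norm_mul, norm_cexp_two_pi_mul, mul_one, Complex.norm_real,
    Real.norm_of_nonneg (Real.sqrt_nonneg _)]

/-- The class of `timeLimitedExp R M n` in `L²(ℝ)`. -/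
def timeLimitedExpLp (R : ℝ) (M : ℕ) (n : ℤ) : SignalSpace :=
  (memLp_timeLimitedExp R M n 2).toLp _

theorem setIntegral_Ioo_cexp {L : ℝ} (hL : 0 ≤ L) {c : ℂ} (hc : c ≠ 0) :
    ∫ t in Set.Ioo (-L) L, Complex.exp (c * t) =
      (Complex.exp (c * L) - Complex.exp (-(c * L))) / c := by
  rw [← integral_Ioc_eq_integral_Ioo, ← intervalIntegral.integral_of_le (by linarith),
    integral_exp_mul_complex hc]
  simp

theorem orthonormal_timeLimitedExpLp {R : ℝ} (hR : 0 < R) {M : ℕ} (hM : 1 ≤ M) :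
    Orthonormal ℂ (timeLimitedExpLp R M) := by
  have hM0 : (0 : ℝ) < M := by exact_mod_cast hM
  have hRM : 0 < R / M := by positivity
  rw [orthonormal_iff_ite]
  intro n m
  have e1 : inner ℂ (timeLimitedExpLp R M n) (timeLimitedExpLp R M m) =
      (R / M : ℝ) * ∫ t in Set.Ioo (-(M / (2 * R))) (M / (2 * R)),
        Complex.exp (2 * Real.pi * Complex.I * ((m - n : ℤ) : ℂ) * ((R / M : ℝ) : ℂ) * t) := by
    rw [L2.inner_def, ← integral_const_mul, ← integral_indicator measurableSet_Ioo]
    refine integral_congr_ae ?_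
    filter_upwards [(memLp_timeLimitedExp R M n 2).coeFn_toLp,
      (memLp_timeLimitedExp R M m 2).coeFn_toLp] with t h1 h2
    rw [timeLimitedExpLp, timeLimitedExpLp, h1, h2, RCLike.inner_apply]
    by_cases ht : t ∈ Set.Ioo (-(M / (2 * R))) (M / (2 * R))
    · simp only [timeLimitedExp, Set.indicator_of_mem ht, map_mul, Complex.conj_ofReal,
        ← Complex.exp_conj, Complex.conj_I, map_ofNat, map_intCast]
      have e2 : (Real.sqrt (R / M) : ℂ) * (Real.sqrt (R / M) : ℂ) = (R / M : ℝ) := by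
        exact_mod_cast Real.mul_self_sqrt hRM.le
      rw [mul_mul_mul_comm, e2, ← Complex.exp_add]
      congr 2
      push_cast
      ring
    · simp [timeLimitedExp, Set.indicator_of_notMem ht]
  rw [e1]
  split_ifs with hnm
  · subst hnm
    simp only [sub_self, Int.cast_zero, mul_zero, zero_mul, Complex.exp_zero]
    rw [setIntegral_const, Real.volume_real_Ioo_of_le (by
      have : 0 ≤ M / (2 * R) := by positivity
      linarith)]
    rw [Complex.real_smul, mul_one, ← Complex.ofReal_mul]
    rw [show R / M * (M / (2 * R) - -(M / (2 * R))) = 1 by field_simp; ring]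
    simp
  · have hk : ((m - n : ℤ) : ℂ) ≠ 0 := by
      exact_mod_cast sub_ne_zero.2 (Ne.symm hnm)
    have hRM' : ((R / M : ℝ) : ℂ) ≠ 0 := by exact_mod_cast hRM.ne'
    rw [setIntegral_Ioo_cexp (by positivity)
      (mul_ne_zero (mul_ne_zero Complex.two_pi_I_ne_zero hk) hRM')]
    have e3 : 2 * Real.pi * Complex.I * ((m - n : ℤ) : ℂ) * ((R / M : ℝ) : ℂ) *
        ((M / (2 * R) : ℝ) : ℂ) = ((m - n : ℤ) : ℂ) * (Real.pi * Complex.I) := by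
      have : ((R / M : ℝ) : ℂ) * ((M / (2 * R) : ℝ) : ℂ) = 1 / 2 := by
        rw [← Complex.ofReal_mul, show R / M * (M / (2 * R)) = 1 / 2 by field_simp]
        simp
      linear_combination (2 * Real.pi * Complex.I * ((m - n : ℤ) : ℂ)) * this
    rw [e3]
    have e4 : Complex.exp (((m - n : ℤ) : ℂ) * (Real.pi * Complex.I)) =
        Complex.exp (-(((m - n : ℤ) : ℂ) * (Real.pi * Complex.I))) := by
      rw [Complex.exp_eq_exp_iff_exists_int]
      exact ⟨m - n, by ring⟩
    rw [e4]
    simp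

theorem mem_timeLimitedFourier_iff {R : ℝ} {M : ℕ} {q : SignalSpace} :
    q ∈ timeLimitedFourier R M ↔ ∃ c : ℤ → ℂ,
      q = ∑ n ∈ Finset.Icc (-(M : ℤ)) M, c n • timeLimitedExpLp R M n := by
  refine exists_congr fun c => ?_
  have e1 : ((∑ n ∈ Finset.Icc (-(M : ℤ)) M, c n • timeLimitedExpLp R M n : SignalSpace) : ℝ → ℂ)
      =ᵐ[volume] (Set.Ioo (-(M / (2 * R))) (M / (2 * R))).indicator (fun t : ℝ =>
      ∑ n ∈ Finset.Icc (-(M : ℤ)) (M : ℤ), (Real.sqrt (R / M) : ℂ) * c n *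
          Complex.exp (2 * Real.pi * Complex.I * n * ((R / M : ℝ) : ℂ) * t)) := by
    have h1 := Lp.coeFn_finsetSum (Finset.Icc (-(M : ℤ)) M)
      (fun n => c n • timeLimitedExpLp R M n)
    have h2 : ∀ᵐ t, ∀ n : ℤ, (c n • timeLimitedExpLp R M n : SignalSpace) t =
        c n * timeLimitedExp R M n t := by
      rw [ae_all_iff]
      intro n
      filter_upwards [Lp.coeFn_smul (c n) (timeLimitedExpLp R M n),
        (memLp_timeLimitedExp R M n 2).coeFn_toLp] with t h3 h4
      rw [h3, Pi.smul_apply, smul_eq_mul, timeLimitedExpLp, h4]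
    filter_upwards [h1, h2] with t h3 h4
    rw [h3, Finset.sum_apply]
    by_cases ht : t ∈ Set.Ioo (-(M / (2 * R))) (M / (2 * R))
    · rw [Set.indicator_of_mem ht]
      refine Finset.sum_congr rfl fun n _ => ?_
      rw [h4, timeLimitedExp, Set.indicator_of_mem ht]
      ring
    · rw [Set.indicator_of_notMem ht]
      refine Finset.sum_eq_zero fun n _ => ?_
      rw [h4, timeLimitedExp, Set.indicator_of_notMem ht, mul_zero]
  constructor
  · intro h
    exact Lp.ext (h.trans e1.symm)
  · rintro rfl
    exact e1

/-- Only the coefficients with index in `[-M, M]` matter, so the discrete signal space is a linear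
space. -/
theorem timeLimitedFourier_eq_span (R : ℝ) (M : ℕ) :
    timeLimitedFourier R M = Submodule.span ℂ
      (Set.range fun n : Finset.Icc (-(M : ℤ)) M => timeLimitedExpLp R M n) := by
  ext q
  rw [mem_timeLimitedFourier_iff, SetLike.mem_coe, Submodule.mem_span_range_iff_exists_fun]
  constructor
  · rintro ⟨c, rfl⟩
    exact ⟨fun n => c n, Finset.sum_coe_sort (Finset.Icc (-(M : ℤ)) M)
      (fun n : ℤ => (c n • timeLimitedExpLp R M n : SignalSpace))⟩
  · rintro ⟨c, rfl⟩
    refine ⟨Function.extend Subtype.val c 0, ?_⟩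
    refine Eq.trans (Finset.sum_congr rfl fun n _ => ?_) (Finset.sum_coe_sort
      (Finset.Icc (-(M : ℤ)) M) (fun n : ℤ =>
        (Function.extend Subtype.val c 0 n • timeLimitedExpLp R M n : SignalSpace)))
    rw [Subtype.val_injective.extend_apply]

theorem span_timeLimitedFourier (R : ℝ) (M : ℕ) :
    Submodule.span ℂ (timeLimitedFourier R M) = Submodule.span ℂ
      (Set.range fun n : Finset.Icc (-(M : ℤ)) M => timeLimitedExpLp R M n) := by
  rw [timeLimitedFourier_eq_span, Submodule.span_eq]

theorem finiteDimensional_span_timeLimitedFourier (R : ℝ) (M : ℕ) :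
    FiniteDimensional ℂ (Submodule.span ℂ (timeLimitedFourier R M)) := by
  rw [span_timeLimitedFourier]
  exact FiniteDimensional.span_of_finite ℂ (Set.finite_range _)

theorem finrank_span_timeLimitedFourier {R : ℝ} (hR : 0 < R) {M : ℕ} (hM : 1 ≤ M) :
    Module.finrank ℂ (Submodule.span ℂ (timeLimitedFourier R M)) = 2 * M + 1 := by
  rw [span_timeLimitedFourier, finrank_span_eq_card, Fintype.card_coe, Int.card_Icc]
  · lia
  · exact (orthonormal_timeLimitedExpLp hR hM).linearIndependent.comp _ Subtype.val_injective

theorem norm_sq_sum_smul_of_orthonormal {ι E : Type*} [NormedAddCommGroup E]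
    [InnerProductSpace ℂ E] {v : ι → E} (hv : Orthonormal ℂ v) (s : Finset ι) (c : ι → ℂ) :
    ‖∑ i ∈ s, c i • v i‖ ^ 2 = ∑ i ∈ s, ‖c i‖ ^ 2 := by
  have h := hv.inner_sum c c s
  rw [inner_self_eq_norm_sq_to_K] at h
  have h2 : ∀ i ∈ s, starRingEnd ℂ (c i) * c i = ((‖c i‖ ^ 2 : ℝ) : ℂ) := fun i _ => by
    rw [mul_comm, Complex.mul_conj, Complex.normSq_eq_norm_sq]
  rw [Finset.sum_congr rfl h2, ← Complex.ofReal_sum] at h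
  refine Complex.ofReal_injective ?_
  rw [← h, Complex.ofReal_pow]
  rfl

theorem norm_fourier_timeLimitedExp_le {R : ℝ} (hR : 0 < R) {M : ℕ} (hM : 1 ≤ M) {n : ℤ}
    (hn : n ∈ Finset.Icc (-(M : ℤ)) M) {z : ℝ} (hz : R < |z|) :
    ‖𝓕 (timeLimitedExp R M n) z‖ ≤ Real.sqrt (R / M) * (1 / (|z| - R)) := by
  have hM0 : (0 : ℝ) < M := by exact_mod_cast hM
  have hzR : 0 < |z| - R := sub_pos.2 hz
  set θ : ℝ := n * (R / M) - z with hθ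
  have hθl : |z| - R ≤ |θ| := by
    have h1 : |(n : ℝ) * (R / M)| ≤ R := by
      rw [abs_mul, abs_of_pos (show 0 < R / M by positivity)]
      have : |(n : ℝ)| ≤ M := by
        rw [Finset.mem_Icc] at hn
        rw [abs_le]
        exact ⟨by exact_mod_cast hn.1, by exact_mod_cast hn.2⟩
      calc |(n : ℝ)| * (R / M) ≤ M * (R / M) := by gcongr
        _ = R := by field_simp
    have h2 := abs_sub_abs_le_abs_sub z (n * (R / M))
    rw [abs_sub_comm] at h2
    linarith
  have hθ0 : θ ≠ 0 := abs_pos.1 (hzR.trans_le hθl)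
  have e1 : 𝓕 (timeLimitedExp R M n) z = (Real.sqrt (R / M) : ℂ) *
      ∫ t in Set.Ioo (-(M / (2 * R))) (M / (2 * R)),
        Complex.exp ((2 * Real.pi * Complex.I * θ) * t) := by
    rw [Real.fourier_real_eq_integral_exp_smul, ← integral_const_mul,
      ← integral_indicator measurableSet_Ioo]
    congr 1
    funext t
    by_cases ht : t ∈ Set.Ioo (-(M / (2 * R))) (M / (2 * R))
    · rw [timeLimitedExp, Set.indicator_of_mem ht, Set.indicator_of_mem ht, smul_eq_mul,
        mul_left_comm, ← Complex.exp_add]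
      congr 2
      rw [hθ]
      push_cast
      ring
    · simp [timeLimitedExp, Set.indicator_of_notMem ht]
  have hθ1 : (θ : ℂ) ≠ 0 := by exact_mod_cast hθ0
  rw [e1, setIntegral_Ioo_cexp (by positivity) (mul_ne_zero Complex.two_pi_I_ne_zero hθ1),
    norm_mul, Complex.norm_real, Real.norm_of_nonneg (Real.sqrt_nonneg _)]
  gcongr
  rw [norm_div]
  have n1 : ∀ y : ℝ, ‖Complex.exp ((y : ℂ) * Complex.I)‖ = 1 := Complex.norm_exp_ofReal_mul_I
  have h3 : ‖Complex.exp (2 * Real.pi * Complex.I * θ * ((M / (2 * R) : ℝ) : ℂ)) -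
      Complex.exp (-(2 * Real.pi * Complex.I * θ * ((M / (2 * R) : ℝ) : ℂ)))‖ ≤ 2 := by
    refine (norm_sub_le _ _).trans ?_
    have a1 := n1 (2 * Real.pi * θ * (M / (2 * R)))
    have a2 := n1 (-(2 * Real.pi * θ * (M / (2 * R))))
    rw [show (2 * Real.pi * Complex.I * θ * ((M / (2 * R) : ℝ) : ℂ) : ℂ) =
      ((2 * Real.pi * θ * (M / (2 * R)) : ℝ) : ℂ) * Complex.I by push_cast; ring, a1,
      ← neg_mul, ← Complex.ofReal_neg, a2]
    norm_num
  have h4 : ‖(2 * Real.pi * Complex.I * θ : ℂ)‖ = 2 * Real.pi * |θ| := by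
    simp [abs_of_pos Real.pi_pos]
  rw [h4]
  calc _ ≤ 2 / (2 * Real.pi * (|z| - R)) := by gcongr
    _ ≤ 2 / (2 * 1 * (|z| - R)) := by
      gcongr
      linarith [Real.pi_gt_three]
    _ = _ := by field_simp

theorem fourier_sum_timeLimitedExpLp (R : ℝ) (M : ℕ) (s : Finset ℤ) (c : ℤ → ℂ) :
    (𝓕 (∑ n ∈ s, c n • timeLimitedExpLp R M n) : SignalSpace) =ᵐ[volume] fun z =>
      ∑ n ∈ s, c n * 𝓕 (timeLimitedExp R M n) z := by
  have e : (𝓕 (∑ n ∈ s, c n • timeLimitedExpLp R M n) : SignalSpace) =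
      ∑ n ∈ s, c n • 𝓕 (timeLimitedExpLp R M n) := by
    change Lp.fourierTransformₗᵢ ℝ ℂ _ = _
    rw [map_sum]
    simp_rw [map_smul]
    rfl
  rw [e]
  have h2 : ∀ᵐ t, ∀ n : ℤ, (c n • 𝓕 (timeLimitedExpLp R M n) : SignalSpace) t =
      c n * 𝓕 (timeLimitedExp R M n) t := by
    rw [ae_all_iff]
    intro n
    filter_upwards [Lp.coeFn_smul (c n) (𝓕 (timeLimitedExpLp R M n) : SignalSpace),
      fourier_toLp_ae_eq (memLp_one_iff_integrable.1 (memLp_timeLimitedExp R M n 1))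
        (memLp_timeLimitedExp R M n 2)] with t h3 h4
    rw [h3, Pi.smul_apply, smul_eq_mul, timeLimitedExpLp, h4]
  filter_upwards [Lp.coeFn_finsetSum s (fun n => c n • (𝓕 (timeLimitedExpLp R M n) : SignalSpace)),
    h2] with z h3 h4
  rw [h3, Finset.sum_apply]
  exact Finset.sum_congr rfl fun n _ => h4 n

/-- Cauchy--Schwarz over the `2 M + 1 ≤ 3 M` basis functions, each of which decays like
`√(R / M) / (|z| - R)`; the factors `M` cancel. -/
theorem norm_sq_fourier_le_of_mem_timeLimitedFourier {R : ℝ} (hR : 0 < R) {M : ℕ} (hM : 1 ≤ M)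
    {s : SignalSpace} (hs : s ∈ timeLimitedFourier R M) :
    ∀ᵐ z : ℝ, R < |z| → ‖(𝓕 s : SignalSpace) z‖ ^ 2 ≤ ‖s‖ ^ 2 * (3 * R / (|z| - R) ^ 2) := by
  obtain ⟨c, rfl⟩ := mem_timeLimitedFourier_iff.1 hs
  filter_upwards [fourier_sum_timeLimitedExpLp R M (Finset.Icc (-(M : ℤ)) M) c] with z hz hzR
  have hM0 : (0 : ℝ) < M := by exact_mod_cast hM
  have hM1 : (1 : ℝ) ≤ M := by exact_mod_cast hM
  have hzR' : 0 < |z| - R := sub_pos.2 hzR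
  rw [hz, norm_sq_sum_smul_of_orthonormal (orthonormal_timeLimitedExpLp hR hM)]
  have h1 : ‖∑ n ∈ Finset.Icc (-(M : ℤ)) M, c n * 𝓕 (timeLimitedExp R M n) z‖ ≤
      ∑ n ∈ Finset.Icc (-(M : ℤ)) M, ‖c n‖ * ‖𝓕 (timeLimitedExp R M n) z‖ :=
    (norm_sum_le _ _).trans (Finset.sum_le_sum fun n _ => (norm_mul _ _).le)
  have h2 : ∑ n ∈ Finset.Icc (-(M : ℤ)) M, ‖𝓕 (timeLimitedExp R M n) z‖ ^ 2 ≤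
      3 * R / (|z| - R) ^ 2 := by
    calc _ ≤ ∑ n ∈ Finset.Icc (-(M : ℤ)) M, (Real.sqrt (R / M) * (1 / (|z| - R))) ^ 2 :=
          Finset.sum_le_sum fun n hn => by
            gcongr
            exact norm_fourier_timeLimitedExp_le hR hM hn hzR
      _ = (2 * M + 1) * (R / M * (1 / (|z| - R)) ^ 2) := by
          rw [Finset.sum_const, nsmul_eq_mul, mul_pow, Real.sq_sqrt (by positivity), Int.card_Icc]
          congr 1
          have : ((M : ℤ) + 1 - -(M : ℤ)).toNat = 2 * M + 1 := by lia
          rw [this]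
          push_cast
          ring
      _ ≤ (3 * M) * (R / M * (1 / (|z| - R)) ^ 2) := by
          gcongr
          linarith
      _ = _ := by field_simp
  calc _ ≤ (∑ n ∈ Finset.Icc (-(M : ℤ)) M, ‖c n‖ * ‖𝓕 (timeLimitedExp R M n) z‖) ^ 2 := by
        gcongr
    _ ≤ _ := Finset.sum_mul_sq_le_sq_mul_sq _ _ _
    _ ≤ _ := by
        gcongr

/-- Fifteen times the mass of `1 / (1 + w²)` outside `(-l, l)`, which for `l ≥ 2` dominates that
of the decay profile `3 / (|w| - 1)²` of time-limited Fourier series in the variable `w = z / R`. -/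
def cauchyTail (l : ℝ) : ℝ≥0∞ :=
  ∫⁻ w in {w : ℝ | l ≤ |w|}, ENNReal.ofReal (15 * (1 + w ^ 2)⁻¹)

theorem tendsto_cauchyTail : Tendsto cauchyTail atTop (𝓝 0) := by
  refine tendsto_setLIntegral_le_abs (by fun_prop) ?_
  have := (integrable_inv_one_add_sq.const_mul (15 : ℝ)).lintegral_lt_top
  exact this.ne

theorem setLIntegral_fourier_le_of_mem_timeLimitedFourier {R : ℝ} (hR : 0 < R) {M : ℕ} (hM : 1 ≤ M)
    {s : SignalSpace} (hs : s ∈ timeLimitedFourier R M) {l : ℝ} (hl : 2 ≤ l) :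
    ∫⁻ z in {z : ℝ | l * R ≤ |z|}, ‖(𝓕 s : SignalSpace) z‖ₑ ^ 2 ≤ ‖s‖ₑ ^ 2 * cauchyTail l := by
  have hf : Measurable (fun w : ℝ => ENNReal.ofReal (15 * (1 + w ^ 2)⁻¹)) := by fun_prop
  have hf' := hf.indicator (measurableSet_le_abs l)
  have hR' : 0 < R⁻¹ := inv_pos.2 hR
  rw [cauchyTail, ← lintegral_indicator (measurableSet_le_abs l),
    ← lintegral_ofReal_mul_comp_mul_sub hR' 0 hf', ← lintegral_const_mul _ (by fun_prop),
    ← lintegral_indicator (measurableSet_le_abs _)]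
  refine lintegral_mono_ae ?_
  filter_upwards [norm_sq_fourier_le_of_mem_timeLimitedFourier hR hM hs] with z hz
  by_cases hzl : l * R ≤ |z|
  · have h2R : 2 * R ≤ |z| := (mul_le_mul_of_nonneg_right hl hR.le).trans hzl
    have hz' := hz (by linarith)
    have hlw : R⁻¹ * (0 - z) ∈ {w : ℝ | l ≤ |w|} := by
      simp only [zero_sub, mul_neg, Set.mem_ofPred_eq, abs_neg, abs_mul, abs_of_pos hR']
      rw [← div_eq_inv_mul, le_div_iff₀ hR]
      exact hzl
    rw [Set.indicator_of_mem (by exact hzl), Set.indicator_of_mem hlw,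
      ← ENNReal.ofReal_mul hR'.le, ← ofReal_norm, ← ofReal_norm s,
      ← ENNReal.ofReal_pow (norm_nonneg _), ← ENNReal.ofReal_pow (norm_nonneg _),
      ← ENNReal.ofReal_mul (by positivity)]
    refine ENNReal.ofReal_le_ofReal (hz'.trans ?_)
    gcongr
    have e : R⁻¹ * (15 * (1 + (R⁻¹ * (0 - z)) ^ 2)⁻¹) = 15 * R / (R ^ 2 + |z| ^ 2) := by
      rw [sq_abs]
      field_simp
      ring
    have hpos : 0 < |z| - R := by linarith
    rw [e, div_le_div_iff₀ (by positivity) (by positivity)]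
    have : 0 ≤ R * ((4 * |z| - 2 * R) * (|z| - 2 * R)) :=
      mul_nonneg hR.le (mul_nonneg (by linarith) (by linarith))
    nlinarith [this]
  · rw [Set.indicator_of_notMem (by exact hzl)]
    exact zero_le

/-! ### Approximation of Paley--Wiener signals -/

/-- Left Riemann sums on `[-R, R]` with `2 M` nodes. -/
theorem tendsto_sum_integral_of_uniformContinuous {F : ℝ → ℂ} (hF : UniformContinuous F) {R : ℝ}
    (hR : 0 < R) :
    Tendsto (fun M : ℕ => ∑ k ∈ Finset.range (2 * M),
      ((R / M : ℝ) : ℂ) * F (((k : ℝ) - M) * (R / M)))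
      atTop (𝓝 (∫ z in (-R)..R, F z)) := by
  rw [Metric.tendsto_nhds]
  intro ε hε
  obtain ⟨δ, hδ, hFδ⟩ := Metric.uniformContinuous_iff.1 hF (ε / (4 * R)) (by positivity)
  have h0 : Tendsto (fun M : ℕ => R / (M : ℝ)) atTop (𝓝 0) :=
    tendsto_const_div_atTop_nhds_zero_nat R
  filter_upwards [h0.eventually (gt_mem_nhds hδ), eventually_ge_atTop 1] with M hMδ hM
  have hM0 : (0 : ℝ) < M := by exact_mod_cast hM
  set d : ℝ := R / M with hd
  have hd0 : 0 < d := by positivity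
  have hint : ∀ x y, IntervalIntegrable F volume x y := fun x y =>
    hF.continuous.intervalIntegrable x y
  have e1 : ∫ z in (-R)..R, F z = ∑ k ∈ Finset.range (2 * M),
      ∫ z in (((k : ℝ) - M) * d)..((((k + 1 : ℕ) : ℝ) - M) * d), F z := by
    rw [intervalIntegral.sum_integral_adjacent_intervals
      (a := fun k : ℕ => ((k : ℝ) - M) * d) (fun k _ => hint _ _)]
    congr 1
    · rw [hd]; push_cast; field_simp; ring
    · rw [hd]; push_cast; field_simp; ring
  have e2 : ∀ k : ℕ, (d : ℂ) * F (((k : ℝ) - M) * d) =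
      ∫ z in (((k : ℝ) - M) * d)..((((k + 1 : ℕ) : ℝ) - M) * d), F (((k : ℝ) - M) * d) := by
    intro k
    rw [intervalIntegral.integral_const, Complex.real_smul]
    congr 2
    push_cast
    ring
  simp_rw [e2]
  rw [e1, dist_eq_norm, ← Finset.sum_sub_distrib]
  have e3 : ∀ k ∈ Finset.range (2 * M),
      ‖(∫ z in (((k : ℝ) - M) * d)..((((k + 1 : ℕ) : ℝ) - M) * d), F (((k : ℝ) - M) * d)) -
        ∫ z in (((k : ℝ) - M) * d)..((((k + 1 : ℕ) : ℝ) - M) * d), F z‖ ≤ ε / (4 * R) * d := by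
    intro k _
    have hle : ((k : ℝ) - M) * d ≤ (((k + 1 : ℕ) : ℝ) - M) * d := by
      push_cast
      gcongr
      linarith
    rw [← intervalIntegral.integral_sub (by simp) (hint _ _)]
    refine (intervalIntegral.norm_integral_le_of_norm_le_const (C := ε / (4 * R))
      fun z hz => ?_).trans_eq ?_
    · rw [Set.uIoc_of_le hle] at hz
      rw [← dist_eq_norm]
      refine (hFδ ?_).le
      rw [Real.dist_eq, abs_sub_comm, abs_of_pos (sub_pos.2 hz.1)]
      have h2 := hz.2
      push_cast at h2
      linarith
    · rw [abs_of_nonneg (sub_nonneg.2 hle)]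
      push_cast
      ring
  refine (norm_sum_le_of_le _ e3).trans_lt ?_
  rw [Finset.sum_const, Finset.card_range, nsmul_eq_mul, hd]
  push_cast
  have : (2 : ℝ) * M * (ε / (4 * R) * (R / M)) = ε / 2 := by field_simp; ring
  rw [this]
  linarith

/-- In `L²`, almost everywhere convergence and convergence of the norms give convergence
(Radon--Riesz). -/
theorem tendsto_Lp_of_tendsto_ae_of_tendsto_norm {q : ℕ → SignalSpace} {s : SignalSpace}
    (hae : ∀ᵐ t, Tendsto (fun M => q M t) atTop (𝓝 (s t)))
    (hn : Tendsto (fun M => ‖q M‖ ^ 2) atTop (𝓝 (‖s‖ ^ 2))) : Tendsto q atTop (𝓝 s) := by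
  -- Fatou's lemma for `q M + s`, combined with the parallelogram law below
  have hF : eLpNorm (s + s : SignalSpace) 2 volume ≤
      atTop.liminf fun M => eLpNorm (q M + s : SignalSpace) 2 volume := by
    refine Lp.eLpNorm_lim_le_liminf_eLpNorm (fun M => (Lp.memLp _).1) _ ?_
    have h1 : ∀ᵐ t, ∀ M, (q M + s : SignalSpace) t = q M t + s t := by
      rw [ae_all_iff]
      exact fun M => Lp.coeFn_add (q M) s
    filter_upwards [hae, h1, Lp.coeFn_add s s] with t h2 h3 h4
    rw [h4]
    simp_rw [h3]
    exact h2.add_const _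
  simp_rw [← Lp.enorm_def] at hF
  rw [tendsto_iff_norm_sub_tendsto_zero]
  have hsq : Tendsto (fun M => ‖q M - s‖ ^ 2) atTop (𝓝 0) := by
    rw [Metric.tendsto_nhds]
    intro ε hε
    have hpar : ∀ M, ‖q M - s‖ ^ 2 = 2 * ‖q M‖ ^ 2 + 2 * ‖s‖ ^ 2 - ‖q M + s‖ ^ 2 := by
      intro M
      have := parallelogram_law_with_norm ℂ (q M) s
      linarith
    have hss : ‖s + s‖ ^ 2 = 4 * ‖s‖ ^ 2 := by
      rw [← two_smul ℝ s, norm_smul]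
      norm_num
      ring
    have hlow : ∀ᶠ M in atTop, ‖s + s‖ ^ 2 - ε / 2 < ‖q M + s‖ ^ 2 := by
      by_cases hneg : ‖s + s‖ ^ 2 - ε / 2 < 0
      · exact .of_forall fun M => hneg.trans_le (sq_nonneg _)
      · rw [not_lt] at hneg
        have hlt : ENNReal.ofReal (Real.sqrt (‖s + s‖ ^ 2 - ε / 2)) < ‖s + s‖ₑ := by
          rw [← ofReal_norm]
          have hlt' : Real.sqrt (‖s + s‖ ^ 2 - ε / 2) < ‖s + s‖ := by
            rw [Real.sqrt_lt hneg (norm_nonneg _)]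
            linarith
          exact (ENNReal.ofReal_lt_ofReal_iff ((Real.sqrt_nonneg _).trans_lt hlt')).2 hlt'
        filter_upwards [eventually_lt_of_lt_liminf (hlt.trans_le hF)] with M hM
        rw [← ofReal_norm] at hM
        have := (ENNReal.ofReal_lt_ofReal_iff_of_nonneg (Real.sqrt_nonneg _)).1 hM
        rwa [Real.sqrt_lt' ((Real.sqrt_nonneg _).trans_lt this)] at this
    filter_upwards [hlow, hn.eventually (gt_mem_nhds (show ‖s‖ ^ 2 < ‖s‖ ^ 2 + ε / 4 by linarith))]
      with M h1 h2
    rw [Real.dist_eq, sub_zero, abs_of_nonneg (sq_nonneg _), hpar]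
    linarith
  have := (Real.continuous_sqrt.tendsto 0).comp hsq
  simpa [Function.comp_def, Real.sqrt_sq] using this

/-- The elements of `timeLimitedFourier R M` whose coefficients sample `F` are Riemann sums of the
inverse Fourier transform of the restriction of `F` to `[-R, R]`. -/
theorem exists_tendsto_of_hasCompactSupport {R : ℝ} (hR : 0 < R) {F : ℝ → ℂ} (hF : Continuous F)
    (hFc : HasCompactSupport F)
    (hΦ : MemLp ((Set.Ioc (-R) R).indicator F) 2 volume) :
    ∃ q : ℕ → SignalSpace, (∀ M, q M ∈ timeLimitedFourier R M) ∧
      Tendsto q atTop (𝓝 (𝓕⁻ (hΦ.toLp _))) := by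
  have hRR : -R ≤ R := by linarith
  have hΦ1 : Integrable ((Set.Ioc (-R) R).indicator F) := by
    rw [integrable_indicator_iff measurableSet_Ioc]
    exact hF.integrableOn_Ioc
  set v : ℕ → ℕ → SignalSpace := fun M k => timeLimitedExpLp R M ((k : ℤ) - M) with hv
  set c : ℕ → ℕ → ℂ := fun M k => (Real.sqrt (R / M) : ℂ) * F (((k : ℝ) - M) * (R / M)) with hc
  refine ⟨fun M => ∑ k ∈ Finset.range (2 * M), c M k • v M k, fun M => ?_,
    tendsto_Lp_of_tendsto_ae_of_tendsto_norm ?_ ?_⟩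
  · rw [timeLimitedFourier_eq_span]
    refine Submodule.sum_mem _ fun k hk => Submodule.smul_mem _ _ (Submodule.subset_span ?_)
    rw [Finset.mem_range] at hk
    exact ⟨⟨(k : ℤ) - M, Finset.mem_Icc.2 ⟨by lia, by lia⟩⟩, rfl⟩
  · have h1 : ∀ᵐ t, ∀ M, (∑ k ∈ Finset.range (2 * M), c M k • v M k : SignalSpace) t =
        ∑ k ∈ Finset.range (2 * M), (c M k • v M k : SignalSpace) t := by
      rw [ae_all_iff]
      intro M
      filter_upwards [Lp.coeFn_finsetSum (Finset.range (2 * M)) (fun k => c M k • v M k)] with t h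
      rw [h, Finset.sum_apply]
    have h2 : ∀ᵐ t, ∀ M k, (c M k • v M k : SignalSpace) t =
        c M k * timeLimitedExp R M ((k : ℤ) - M) t := by
      simp_rw [ae_all_iff]
      intro M k
      filter_upwards [Lp.coeFn_smul (c M k) (v M k),
        (memLp_timeLimitedExp R M ((k : ℤ) - M) 2).coeFn_toLp] with t h3 h4
      rw [h3, Pi.smul_apply, smul_eq_mul]
      exact congrArg _ h4
    filter_upwards [h1, h2, fourierInv_toLp_ae_eq hΦ1 hΦ] with t h3 h4 h5
    rw [h5]
    have e1 : 𝓕⁻ ((Set.Ioc (-R) R).indicator F) t =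
        ∫ z in (-R)..R, F z * Complex.exp (2 * Real.pi * Complex.I * z * t) := by
      rw [intervalIntegral.integral_of_le hRR, ← integral_indicator measurableSet_Ioc,
        Real.fourierInv_eq']
      congr 1
      funext z
      by_cases hz : z ∈ Set.Ioc (-R) R
      · rw [Set.indicator_of_mem hz, Set.indicator_of_mem hz, smul_eq_mul, mul_comm]
        congr 2
        simp only [RCLike.inner_apply, conj_trivial]
        push_cast
        ring
      · rw [Set.indicator_of_notMem hz, Set.indicator_of_notMem hz, smul_zero]
    rw [e1]
    have hUC : UniformContinuous
        (fun z : ℝ => F z * Complex.exp (2 * Real.pi * Complex.I * z * t)) :=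
      (hFc.mul_right).uniformContinuous_of_continuous (by fun_prop)
    refine (tendsto_sum_integral_of_uniformContinuous hUC hR).congr' ?_
    have ht : Tendsto (fun M : ℕ => (M : ℝ) / (2 * R)) atTop atTop :=
      tendsto_natCast_atTop_atTop.atTop_div_const (by positivity)
    filter_upwards [ht.eventually_gt_atTop |t|] with M hM
    rw [h3]
    refine Finset.sum_congr rfl fun k _ => ?_
    have ht' : t ∈ Set.Ioo (-((M : ℝ) / (2 * R))) (M / (2 * R)) := abs_lt.1 hM
    rw [h4, timeLimitedExp, Set.indicator_of_mem ht']
    have e2 : (Real.sqrt (R / M) : ℂ) * (Real.sqrt (R / M) : ℂ) = (R / M : ℝ) := by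
      exact_mod_cast Real.mul_self_sqrt (by positivity)
    have e3 : 2 * Real.pi * Complex.I * ((((k : ℝ) - M) * (R / M) : ℝ) : ℂ) * t =
        2 * Real.pi * Complex.I * (((k : ℤ) - M : ℤ) : ℂ) * ((R / M : ℝ) : ℂ) * t := by
      push_cast
      ring
    rw [e3, ← e2]
    simp only [hc]
    ring
  · have hnorm : ‖(𝓕⁻ (hΦ.toLp _) : SignalSpace)‖ ^ 2 = ∫ z in (-R)..R, ‖F z‖ ^ 2 := by
      have e1 : ‖(𝓕⁻ (hΦ.toLp _) : SignalSpace)‖ = ‖hΦ.toLp _‖ :=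
        (Lp.fourierTransformₗᵢ ℝ ℂ).symm.norm_map _
      have e2 := L2.inner_def (𝕜 := ℂ) (hΦ.toLp _) (hΦ.toLp _)
      rw [inner_self_eq_norm_sq_to_K] at e2
      rw [e1]
      refine Complex.ofReal_injective ?_
      rw [Complex.ofReal_pow]
      refine e2.trans ?_
      rw [intervalIntegral.integral_of_le hRR, ← integral_indicator measurableSet_Ioc,
        ← integral_complex_ofReal]
      refine integral_congr_ae ?_
      filter_upwards [hΦ.coeFn_toLp] with z hz
      rw [hz]
      by_cases hz : z ∈ Set.Ioc (-R) R
      · rw [Set.indicator_of_mem hz, Set.indicator_of_mem hz, inner_self_eq_norm_sq_to_K]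
        norm_cast
      · simp [Set.indicator_of_notMem hz]
    rw [hnorm]
    have hUC : UniformContinuous (fun z : ℝ => ((‖F z‖ ^ 2 : ℝ) : ℂ)) := by
      refine HasCompactSupport.uniformContinuous_of_continuous ?_ (by fun_prop)
      exact hFc.comp_left (g := fun w : ℂ => ((‖w‖ ^ 2 : ℝ) : ℂ)) (by simp)
    have hlim := tendsto_sum_integral_of_uniformContinuous hUC hR
    rw [intervalIntegral.integral_ofReal] at hlim
    have hlim' := (Complex.continuous_re.tendsto _).comp hlim
    rw [Complex.ofReal_re] at hlim'
    refine hlim'.congr' ?_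
    filter_upwards [eventually_ge_atTop 1] with M hM
    have hinj : Function.Injective (fun k : ℕ => (k : ℤ) - M) := fun k l hkl => by
      simpa using hkl
    have := norm_sq_sum_smul_of_orthonormal
      ((orthonormal_timeLimitedExpLp hR hM).comp _ hinj) (Finset.range (2 * M)) (c M)
    simp only [Function.comp_def] at this ⊢
    rw [this, Complex.re_sum]
    refine Finset.sum_congr rfl fun k _ => ?_
    rw [← Complex.ofReal_mul, Complex.ofReal_re]
    simp only [hc]
    rw [norm_mul, mul_pow, Complex.norm_real, Real.norm_of_nonneg (Real.sqrt_nonneg _),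
      Real.sq_sqrt (by positivity)]

/-- Orthogonal projections are the best approximations, so they are at least as good as the
Riemann sums for a nearby signal with continuous Fourier transform. -/
theorem exists_tendsto_of_mem_paleyWiener {R : ℝ} (hR : 0 < R) {s : SignalSpace}
    (hs : s ∈ paleyWiener R) :
    ∃ u : ℕ → SignalSpace, (∀ M : ℕ, u M ∈ timeLimitedFourier R M) ∧ Tendsto u atTop (𝓝 s) := by
  set U : ℕ → Submodule ℂ SignalSpace := fun M => Submodule.span ℂ (timeLimitedFourier R M) with hU
  have hUmem : ∀ M q, q ∈ U M ↔ q ∈ timeLimitedFourier R M := by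
    intro M q
    rw [hU]
    simp only
    rw [span_timeLimitedFourier, timeLimitedFourier_eq_span]
    rfl
  have hfd : ∀ M, FiniteDimensional ℂ (U M) := finiteDimensional_span_timeLimitedFourier R
  refine ⟨fun M => (U M).starProjection s, fun M => (hUmem M _).1
    ((U M).starProjection_apply_mem s), ?_⟩
  rw [Metric.tendsto_nhds]
  intro ε hε
  obtain ⟨F, hFc, hFε, hF, hF2⟩ :=
    (Lp.memLp (𝓕 s : SignalSpace)).exists_hasCompactSupport_eLpNorm_sub_le (by norm_num)
      (ε := ENNReal.ofReal (ε / 2)) (by simpa using hε)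
  have hΦ : MemLp ((Set.Ioc (-R) R).indicator F) 2 volume := hF2.indicator measurableSet_Ioc
  obtain ⟨q, hqm, hq⟩ := exists_tendsto_of_hasCompactSupport hR hF hFc hΦ
  have hd : ‖s - 𝓕⁻ (hΦ.toLp _)‖ ≤ ε / 2 := by
    have e1 : ‖s - 𝓕⁻ (hΦ.toLp _)‖ = ‖(𝓕 s : SignalSpace) - hΦ.toLp _‖ := by
      rw [← Lp.norm_fourier_eq (s - _)]
      congr 1
      change Lp.fourierTransformₗᵢ ℝ ℂ _ = _
      rw [map_sub]
      congr 1
      exact (Lp.fourierTransformₗᵢ ℝ ℂ).apply_symm_apply _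
    rw [e1, Lp.norm_def]
    refine ENNReal.toReal_le_of_le_ofReal (by positivity) (le_trans ?_ hFε)
    refine eLpNorm_mono_ae ?_
    -- the left end point of `[-R, R]` is missing in `Ioc`, which suits interval integrals
    have hneg : ∀ᵐ z : ℝ, z ≠ -R := by simp [ae_iff]
    filter_upwards [Lp.coeFn_sub (𝓕 s : SignalSpace) (hΦ.toLp _), hΦ.coeFn_toLp, hs, hneg]
      with z h1 h2 h3 h4
    rw [h1, Pi.sub_apply, Pi.sub_apply, h2]
    by_cases hz : z ∈ Set.Ioc (-R) R
    · rw [Set.indicator_of_mem hz]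
    · rw [Set.indicator_of_notMem hz, h3, sub_zero, norm_zero]
      · exact norm_nonneg _
      · exact fun hz' => hz ⟨lt_of_le_of_ne hz'.1 (Ne.symm h4), hz'.2⟩
  filter_upwards [Metric.tendsto_nhds.1 hq (ε / 2) (by positivity)] with M hM
  have hmin : ‖s - (U M).starProjection s‖ ≤ ‖s - q M‖ := by
    rw [Submodule.starProjection_minimal]
    exact ciInf_le ⟨0, by rintro _ ⟨x, rfl⟩; exact norm_nonneg _⟩
      (⟨q M, (hUmem M _).2 (hqm M)⟩ : U M)
  rw [dist_comm, dist_eq_norm]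
  calc _ ≤ ‖s - q M‖ := hmin
    _ ≤ ‖s - 𝓕⁻ (hΦ.toLp _)‖ + ‖𝓕⁻ (hΦ.toLp _) - q M‖ := norm_sub_le_norm_sub_add_norm_sub _ _ _
    _ < ε / 2 + ε / 2 := by
        refine add_lt_add_of_le_of_lt hd ?_
        rwa [dist_comm, dist_eq_norm] at hM
    _ = ε := by ring

theorem isDiscretization_timeLimitedFourier {R : ℝ} (hR : 0 < R) :
    IsDiscretization (paleyWiener R) (timeLimitedFourier R) where
  finiteDimensional M _ := finiteDimensional_span_timeLimitedFourier R M
  resolution := by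
    refine ⟨2, 3, by norm_num, by norm_num, fun M hM => ?_⟩
    have hM' : (1 : ℝ) ≤ M := by exact_mod_cast hM
    rw [finrank_span_timeLimitedFourier hR hM]
    push_cast
    constructor <;> linarith
  approx s hs := by
    obtain ⟨u, hu, hs⟩ := exists_tendsto_of_mem_paleyWiener hR hs
    exact ⟨u, fun M _ => hu M, hs⟩

/-! ### The frame property and the envelopes -/

/-- The relative error of the envelopes is made small by choosing `l`, then `W` large. -/
theorem exists_truncation_threshold {h : ℝ → ℝ} (h1 : Integrable (fun t => (h t : ℂ)))
    (h2 : MemLp h 2 volume) {τ₁ : ℝ} (hτ₁ : 0 < τ₁) {e : ℝ≥0∞} (he : 0 < e) :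
    ∃ W₀ : ℝ, ∀ W, W₀ ≤ W → 1 ≤ W ∧ ∃ l, 2 ≤ l ∧ l ≤ W ∧
      cauchyTail l * windowTail h 0 + windowTail h (τ₁ * (W - l)) < e := by
  have hH : windowTail h 0 ≠ ∞ := ((setLIntegral_le_lintegral _ _).trans_lt
    (lintegral_windowFourier_sq_lt_top h1 h2)).ne
  have t1 : Tendsto (fun l => cauchyTail l * windowTail h 0) atTop (𝓝 0) := by
    simpa using ENNReal.Tendsto.mul_const tendsto_cauchyTail (Or.inr hH)
  obtain ⟨l, hl, hl2⟩ := ((t1.eventually (gt_mem_nhds he)).and (eventually_ge_atTop 2)).exists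
  have t2 : Tendsto (fun W => cauchyTail l * windowTail h 0 + windowTail h (τ₁ * (W - l))) atTop
      (𝓝 (cauchyTail l * windowTail h 0 + 0)) := by
    refine tendsto_const_nhds.add ((tendsto_windowTail h1 h2).comp ?_)
    exact (tendsto_atTop_add_const_right atTop (-l) tendsto_id).const_mul_atTop hτ₁
  rw [add_zero] at t2
  obtain ⟨W₀, hW₀⟩ := eventually_atTop.1 ((t2.eventually (gt_mem_nhds hl)).and
    (eventually_ge_atTop l))
  exact ⟨W₀, fun W hW => ⟨by linarith [(hW₀ W hW).2], l, hl2, (hW₀ W hW).2, (hW₀ W hW).1⟩⟩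

namespace IsLTFTData

variable {τ₁ τ₂ : ℝ} {h : ℝ → ℝ} {a b : Set.Icc τ₁ τ₂ → ℝ}

theorem lintegral_coeffFun_sq_ge (D : IsLTFTData h a b) (μ₃ : Measure (Set.Icc τ₁ τ₂))
    [IsProbabilityMeasure μ₃] {δ κ : ℝ} (hδ : 0 < δ) (hκ : 0 < κ)
    (hh : ∀ u, |u| ≤ δ → κ ≤ ‖windowFourier h u‖) (s : SignalSpace) :
    ENNReal.ofReal (κ ^ 2 * (δ / (1 + δ / τ₁))) * ‖s‖ₑ ^ 2 ≤
      ∫⁻ g, ‖coeffFun (ltftAtom h a b) s g‖ₑ ^ 2 ∂(ltftMeasure μ₃) := by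
  rw [ltftMeasure, D.lintegral_coeffFun_sq, ← lintegral_enorm_sq_fourier_eq,
    ← lintegral_const_mul' _ _ ENNReal.ofReal_ne_top]
  refine lintegral_mono fun z => ?_
  rw [mul_comm]
  gcongr
  exact D.lintegral_atomSpectrum_ge μ₃ hδ hκ hh z

theorem isContinuousFrame (D : IsLTFTData h a b) (μ₃ : Measure (Set.Icc τ₁ τ₂))
    [IsProbabilityMeasure μ₃] {R a₀ : ℝ} (hb : ∀ τ, b τ < R) (ha₀ : 0 < a₀) (ha : ∀ τ, a₀ ≤ a τ)
    {δ κ : ℝ} (hδ : 0 < δ) (hκ : 0 < κ)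
    (hh : ∀ u, |u| ≤ δ → κ ≤ ‖windowFourier h u‖) :
    IsContinuousFrame (ltftMeasure μ₃) (ltftAtom h a b) := by
  obtain ⟨B, hB0, hB⟩ := D.exists_lintegral_atomSpectrum_le μ₃ hb ha₀ ha
  have hτ1 := D.pos_left
  set A : ℝ := κ ^ 2 * (δ / (1 + δ / τ₁)) with hA
  have hA0 : 0 < A := by positivity
  have hle : ∀ s, ∫⁻ g, ‖coeffFun (ltftAtom h a b) s g‖ₑ ^ 2 ∂(ltftMeasure μ₃) ≤
      ENNReal.ofReal B * ‖s‖ₑ ^ 2 := by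
    intro s
    rw [ltftMeasure, D.lintegral_coeffFun_sq, ← lintegral_enorm_sq_fourier_eq,
      ← lintegral_const_mul' _ _ ENNReal.ofReal_ne_top]
    refine lintegral_mono fun z => ?_
    rw [mul_comm]
    gcongr
    exact hB z
  have hfin : ∀ s : SignalSpace, ENNReal.ofReal B * ‖s‖ₑ ^ 2 ≠ ∞ := fun s : SignalSpace =>
    ENNReal.mul_ne_top ENNReal.ofReal_ne_top (ENNReal.pow_ne_top enorm_ne_top)
  have hreal : ∀ (s : SignalSpace) (c : ℝ), 0 ≤ c →
      (ENNReal.ofReal c * ‖s‖ₑ ^ 2).toReal = c * ‖s‖ ^ 2 := fun s c hc => by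
    rw [ENNReal.toReal_mul, ENNReal.toReal_ofReal hc, ENNReal.toReal_pow, toReal_enorm]
  refine ⟨D.measurable_coeffFun, fun s => ⟨(D.measurable_coeffFun s).aestronglyMeasurable, ?_⟩,
    A, max A B, hA0, le_max_left _ _, fun s => ?_⟩
  · refine (ENNReal.pow_lt_top_iff (n := 2).1 ?_).resolve_right two_ne_zero
    rw [eLpNorm_two_sq]
    exact (hle s).trans_lt (hfin s).lt_top
  · rw [← ENNReal.toReal_pow, eLpNorm_two_sq]
    constructor
    · rw [← hreal s A hA0.le]
      exact ENNReal.toReal_mono ((hle s).trans_lt (hfin s).lt_top).ne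
        (D.lintegral_coeffFun_sq_ge μ₃ hδ hκ hh s)
    · refine (ENNReal.toReal_mono (hfin s) (hle s)).trans ?_
      rw [hreal s B hB0]
      gcongr
      exact le_max_right _ _

/-- The atom is supported within `τ / (2 a τ)` of `x`, away from the support of the signal. -/
theorem coeffFun_eq_zero_of_le_abs (D : IsLTFTData h a b)
    (h_supp : Function.support h ⊆ Set.Icc (-1 / 2) (1 / 2)) {R : ℝ} {M : ℕ} {s : SignalSpace}
    (hs : s ∈ timeLimitedFourier R M) {x : ℝ} {p : ℝ × Set.Icc τ₁ τ₂}
    (hx : M / (2 * R) + τ₂ / a p.2 ≤ |x|) : coeffFun (ltftAtom h a b) s (x, p) = 0 := by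
  obtain ⟨ω, τ⟩ := p
  obtain ⟨c, hc⟩ := hs
  rw [coeffFun, L2.inner_def, D.ltftAtom_eq]
  refine integral_eq_zero_of_ae ?_
  filter_upwards [hc, (D.memLp_atomFun (x, ω, τ)).coeFn_toLp] with t h1 h2
  rw [h1, h2, Pi.zero_apply]
  by_cases ht : t ∈ Set.Ioo (-(M / (2 * R))) (M / (2 * R))
  · have hα := D.pos_a τ
    have hτ : (0 : ℝ) < τ := D.pos_left.trans_le τ.2.1
    have hσ0 := D.scale_ne_zero (ω, τ)
    have hσ := abs_ltftScale (ω := ω) hα (D.a_lt_b τ) hτ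
    have htx : τ₂ / a τ < |t - x| := by
      have h3 := abs_lt.2 ht
      have h4 := abs_sub_abs_le_abs_sub x t
      rw [abs_sub_comm] at h4
      simp only at hx
      linarith
    have h0 : h ((ltftScale (a τ) (b τ) ω τ)⁻¹ * (t - x)) = 0 := by
      by_contra hne
      have h3 : |(ltftScale (a τ) (b τ) ω τ)⁻¹ * (t - x)| ≤ 1 := by
        have := h_supp hne
        rw [abs_le]
        constructor <;> linarith [this.1, this.2]
      rw [abs_mul, abs_inv, inv_mul_le_iff₀ (abs_pos.2 hσ0), mul_one, hσ] at h3
      have h4 : (τ : ℝ) / max (a τ) (min |ω| (b τ)) ≤ τ₂ / a τ := by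
        have := hτ.le.trans τ.2.2
        gcongr
        · exact τ.2.2
        · exact le_max_left _ _
      linarith
    rw [ltftAtomFun_apply, h0]
    simp
  · rw [Set.indicator_of_notMem ht, inner_zero_right]

/-- The error of the envelope comes from `|ω| ≥ W R`. Signal frequencies beyond `l R` have energy
at most `‖s‖² cauchyTail l`, the others only meet the tail of the window response. -/
theorem eLpNorm_coeffFun_sub_envelope_sq_le (D : IsLTFTData h a b)
    (h_supp : Function.support h ⊆ Set.Icc (-1 / 2) (1 / 2)) (μ₃ : Measure (Set.Icc τ₁ τ₂))
    [IsProbabilityMeasure μ₃] {R W l : ℝ} (hR : 0 < R) (hb : ∀ τ, b τ < R) (hW : 1 ≤ W)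
    (hl : 2 ≤ l) (hlW : l ≤ W) {M : ℕ} (hM : 1 ≤ M) {s : SignalSpace}
    (hs : s ∈ timeLimitedFourier R M) :
    eLpNorm (fun g => coeffFun (ltftAtom h a b) s g -
      (ltftEnvelope a R W M g : ℂ) * coeffFun (ltftAtom h a b) s g) 2 (ltftMeasure μ₃) ^ 2 ≤
      ‖s‖ₑ ^ 2 * (cauchyTail l * windowTail h 0 + windowTail h (τ₁ * (W - l))) := by
  have hS : Measurable (𝓕 s : SignalSpace) := (Lp.stronglyMeasurable _).measurable
  have hmeas : MeasurableSet {g : LTFTPhaseSpace τ₁ τ₂ | W * R ≤ |g.2.1|} :=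
    (measurableSet_le_abs (W * R)).preimage (measurable_fst.comp measurable_snd)
  have hμ : (ltftMeasure μ₃).restrict {g | W * R ≤ |g.2.1|} =
      volume.prod ((volume.restrict {ω : ℝ | W * R ≤ |ω|}).prod μ₃) := by
    have e : {g : LTFTPhaseSpace τ₁ τ₂ | W * R ≤ |g.2.1|} =
        Set.univ ×ˢ ({ω : ℝ | W * R ≤ |ω|} ×ˢ Set.univ) := by
      ext g; simp
    rw [e, ltftMeasure, ← Measure.prod_restrict, ← Measure.prod_restrict, Measure.restrict_univ,
      Measure.restrict_univ]
  rw [eLpNorm_two_sq]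
  calc _ ≤ ∫⁻ g in {g | W * R ≤ |g.2.1|}, ‖coeffFun (ltftAtom h a b) s g‖ₑ ^ 2
        ∂(ltftMeasure μ₃) := by
        rw [← lintegral_indicator hmeas]
        refine lintegral_mono fun g => ?_
        by_cases hg : g ∈ ltftDomain a R W M
        · simp [ltftEnvelope, hg]
        · by_cases hg' : W * R ≤ |g.2.1|
          · rw [Set.indicator_of_mem (by exact hg')]
            simp [ltftEnvelope, hg]
          · have hx : M / (2 * R) + τ₂ / a g.2.2 ≤ |g.1| := by
              by_contra hx
              exact hg ⟨not_le.1 hg', not_le.1 hx⟩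
            have := D.coeffFun_eq_zero_of_le_abs h_supp hs hx
            simp [this]
    _ = ∫⁻ z, ‖(𝓕 s : SignalSpace) z‖ₑ ^ 2 * ∫⁻ p, ‖atomSpectrum h a b z p‖ₑ ^ 2
          ∂((volume.restrict {ω : ℝ | W * R ≤ |ω|}).prod μ₃) := by
        rw [hμ, D.lintegral_coeffFun_sq]
    _ ≤ ∫⁻ z, ({z : ℝ | l * R ≤ |z|}.indicator
          (fun z => ‖(𝓕 s : SignalSpace) z‖ₑ ^ 2 * windowTail h 0) z +
          ‖(𝓕 s : SignalSpace) z‖ₑ ^ 2 * windowTail h (τ₁ * (W - l))) := by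
        refine lintegral_mono fun z => ?_
        by_cases hz : l * R ≤ |z|
        · rw [Set.indicator_of_mem (by exact hz)]
          refine le_add_of_le_of_nonneg ?_ zero_le
          gcongr
          refine D.lintegral_atomSpectrum_high_le μ₃ hb hW fun τ ω _ => ?_
          have := D.pos_b τ
          have hτ : (0 : ℝ) < τ := D.pos_left.trans_le τ.2.1
          positivity
        · rw [Set.indicator_of_notMem (by exact hz), zero_add]
          gcongr
          exact D.lintegral_atomSpectrum_high_le_of_abs_le μ₃ hb hW hlW (not_le.1 hz).le
    _ = (∫⁻ z in {z : ℝ | l * R ≤ |z|}, ‖(𝓕 s : SignalSpace) z‖ₑ ^ 2) * windowTail h 0 +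
          ‖s‖ₑ ^ 2 * windowTail h (τ₁ * (W - l)) := by
        rw [lintegral_add_left ((by fun_prop : Measurable _).indicator (measurableSet_le_abs _)),
          lintegral_indicator (measurableSet_le_abs _), lintegral_mul_const _ (by fun_prop),
          lintegral_mul_const _ (by fun_prop), lintegral_enorm_sq_fourier_eq]
    _ ≤ ‖s‖ₑ ^ 2 * cauchyTail l * windowTail h 0 +
          ‖s‖ₑ ^ 2 * windowTail h (τ₁ * (W - l)) := by
        gcongr
        exact setLIntegral_fourier_le_of_mem_timeLimitedFourier hR hM hs hl
    _ = _ := by ring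

theorem measurableSet_ltftDomain (D : IsLTFTData h a b) (R W : ℝ) (M : ℕ) :
    MeasurableSet (ltftDomain a R W M) := by
  have := D.measurable_a
  rw [ltftDomain, Set.ofPred_and]
  refine MeasurableSet.inter (measurableSet_lt ?_ ?_) (measurableSet_lt ?_ ?_)
  · exact (measurable_fst.comp measurable_snd).norm
  · exact measurable_const
  · exact measurable_fst.norm
  · fun_prop

theorem ltftMeasure_ltftDomain_le (μ₃ : Measure (Set.Icc τ₁ τ₂)) [IsProbabilityMeasure μ₃]
    (hτ₂ : 0 ≤ τ₂) {a₀ : ℝ} (ha₀ : 0 < a₀) (ha : ∀ τ, a₀ ≤ a τ) {R W : ℝ} (M : ℕ) :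
    ltftMeasure μ₃ (ltftDomain a R W M) ≤
      ENNReal.ofReal (2 * (M / (2 * R) + τ₂ / a₀)) * ENNReal.ofReal (2 * (W * R)) := by
  have hsub : ltftDomain a R W M ⊆
      Set.Ioo (-(M / (2 * R) + τ₂ / a₀)) (M / (2 * R) + τ₂ / a₀) ×ˢ
        (Set.Ioo (-(W * R)) (W * R) ×ˢ (Set.univ : Set (Set.Icc τ₁ τ₂))) := by
    rintro g ⟨h1, h2⟩
    refine ⟨abs_lt.1 (h2.trans_le ?_), abs_lt.1 h1, Set.mem_univ _⟩
    gcongr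
    exact ha _
  refine (measure_mono hsub).trans_eq ?_
  rw [ltftMeasure, Measure.prod_prod, Measure.prod_prod, Real.volume_Ioo, Real.volume_Ioo,
    measure_univ, mul_one]
  congr 2 <;> ring

theorem hasLinearVolumeEnvelopes (D : IsLTFTData h a b)
    (h_supp : Function.support h ⊆ Set.Icc (-1 / 2) (1 / 2)) (μ₃ : Measure (Set.Icc τ₁ τ₂))
    [IsProbabilityMeasure μ₃] (hτ₂ : 0 < τ₂) {R a₀ : ℝ} (hR : 0 < R) (hb : ∀ τ, b τ < R)
    (ha₀ : 0 < a₀) (ha : ∀ τ, a₀ ≤ a τ) {δ κ : ℝ} (hδ : 0 < δ) (hκ : 0 < κ)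
    (hh : ∀ u, |u| ≤ δ → κ ≤ ‖windowFourier h u‖) {W l ε : ℝ} (hW : 1 ≤ W)
    (hl : 2 ≤ l) (hlW : l ≤ W)
    (hε : cauchyTail l * windowTail h 0 + windowTail h (τ₁ * (W - l)) <
      ENNReal.ofReal ε ^ 2 * ENNReal.ofReal (κ ^ 2 * (δ / (1 + δ / τ₁)))) :
    HasLinearVolumeEnvelopes (ltftMeasure μ₃) (ltftAtom h a b) (timeLimitedFourier R)
      (ltftEnvelope a R W) ε := by
  have hW0 : 0 < W := by linarith
  refine ⟨(1 / R + 2 * (τ₂ / a₀)) * (2 * (W * R)), by positivity, 1,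
    fun M hM => ⟨fun g => ?_, ?_, ?_, fun s hs hs0 => ?_⟩⟩
  · exact Set.indicator_nonneg (fun _ _ => zero_le_one) g
  · rw [ltftEnvelope, integrable_indicator_iff (D.measurableSet_ltftDomain R W M)]
    refine integrableOn_const (C := (1 : ℝ))
      ((ltftMeasure_ltftDomain_le μ₃ hτ₂.le ha₀ ha M).trans_lt
      (ENNReal.mul_lt_top ENNReal.ofReal_lt_top ENNReal.ofReal_lt_top)).ne
  · have hM1 : (1 : ℝ) ≤ M := by exact_mod_cast hM
    have e : ∀ g, |ltftEnvelope a R W M g| = (ltftDomain a R W M).indicator 1 g := fun g =>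
      abs_of_nonneg (Set.indicator_nonneg (fun _ _ => zero_le_one) g)
    simp_rw [e]
    rw [integral_indicator_one (D.measurableSet_ltftDomain R W M), Measure.real]
    refine ENNReal.toReal_le_of_le_ofReal (by positivity)
      ((ltftMeasure_ltftDomain_le μ₃ hτ₂.le ha₀ ha M).trans ?_)
    rw [← ENNReal.ofReal_mul (by positivity)]
    refine ENNReal.ofReal_le_ofReal ?_
    have h1 : 2 * (M / (2 * R) + τ₂ / a₀) ≤ (1 / R + 2 * (τ₂ / a₀)) * M := by
      have e1 : 2 * (M / (2 * R) + τ₂ / a₀) = 1 / R * M + 2 * (τ₂ / a₀) * 1 := by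
        field_simp
      rw [e1, add_mul]
      gcongr
    calc _ ≤ (1 / R + 2 * (τ₂ / a₀)) * M * (2 * (W * R)) := by gcongr
      _ = _ := by ring
  · have hs1 : ‖s‖ₑ ^ 2 ≠ 0 := by simpa using hs0
    have hs2 : ‖s‖ₑ ^ 2 ≠ ∞ := ENNReal.pow_ne_top enorm_ne_top
    have hsq : eLpNorm (fun g => coeffFun (ltftAtom h a b) s g -
        (ltftEnvelope a R W M g : ℂ) * coeffFun (ltftAtom h a b) s g) 2 (ltftMeasure μ₃) ^ 2 <
        (ENNReal.ofReal ε * eLpNorm (coeffFun (ltftAtom h a b) s) 2 (ltftMeasure μ₃)) ^ 2 := by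
      refine (D.eLpNorm_coeffFun_sub_envelope_sq_le h_supp μ₃ hR hb hW hl hlW hM hs).trans_lt
        (((ENNReal.mul_lt_mul_iff_right hs1 hs2).2 hε).trans_le ?_)
      rw [mul_pow, eLpNorm_two_sq, mul_left_comm, mul_comm (‖s‖ₑ ^ 2)]
      gcongr
      exact D.lintegral_coeffFun_sq_ge μ₃ hδ hκ hh s
    exact lt_of_pow_lt_pow_left' 2 hsq

end IsLTFTData

theorem proposition5p5
    (h : ℝ → ℝ) (h_nonneg : ∀ t, 0 ≤ h t)
    (h_supp : Function.support h ⊆ Set.Icc (-1 / 2) (1 / 2))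
    (h_memLp : MemLp h 2 volume) (h_ne : ¬ h =ᵐ[volume] 0)
    (τ₁ τ₂ : ℝ) (hτ₁ : 0 < τ₁) (hτ : τ₁ < τ₂) :
    -- the threshold for `W`, as a function of `ε` (and of the fixed `h`, `τ₁`, `τ₂`) only
    ∃ W₀ : ℝ → ℝ,
      ∀ (μ₃ : Measure (Set.Icc τ₁ τ₂)) [IsProbabilityMeasure μ₃],
        -- `μ₃` is absolutely continuous with respect to Lebesgue measure on `[τ₁, τ₂]`
        μ₃ ≪ Measure.comap ((↑) : Set.Icc τ₁ τ₂ → ℝ) volume →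
      ∀ (a b : Set.Icc τ₁ τ₂ → ℝ), Measurable a → Measurable b →
        (∃ a₀ : ℝ, 0 < a₀ ∧ ∀ τ, a₀ ≤ a τ) → (∀ τ, a τ < b τ) →
      ∀ R : ℝ, 0 < R → (∀ τ, b τ < R) →
        IsLinearVolumeDiscretizable (ltftMeasure μ₃) (ltftAtom h a b)
          (paleyWiener R) (timeLimitedFourier R) ∧
        ∀ ε : ℝ, 0 < ε → ∀ W : ℝ, W₀ ε ≤ W →
          HasLinearVolumeEnvelopes (ltftMeasure μ₃) (ltftAtom h a b)
            (timeLimitedFourier R) (ltftEnvelope a R W) ε := by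
  have h1 := integrable_window h_supp h_memLp
  obtain ⟨δ, κ, hδ, hκ, hh⟩ := exists_windowFourier_lower h_nonneg h1 h_ne
  have hthr : ∀ ε : ℝ, ∃ W₀ : ℝ, 0 < ε → ∀ W, W₀ ≤ W → 1 ≤ W ∧ ∃ l, 2 ≤ l ∧ l ≤ W ∧
      cauchyTail l * windowTail h 0 + windowTail h (τ₁ * (W - l)) <
        ENNReal.ofReal ε ^ 2 * ENNReal.ofReal (κ ^ 2 * (δ / (1 + δ / τ₁))) := by
    intro ε
    by_cases hε : 0 < ε
    · have hpos : 0 < ENNReal.ofReal ε ^ 2 * ENNReal.ofReal (κ ^ 2 * (δ / (1 + δ / τ₁))) :=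
        ENNReal.mul_pos (pow_ne_zero _ (ENNReal.ofReal_pos.2 hε).ne')
          (ENNReal.ofReal_pos.2 (by positivity)).ne'
      obtain ⟨W₀, hW₀⟩ := exists_truncation_threshold h1 h_memLp hτ₁ hpos
      exact ⟨W₀, fun _ => hW₀⟩
    · exact ⟨0, fun h => absurd h hε⟩
  choose W₀ hW₀ using hthr
  refine ⟨W₀, fun μ₃ _ _ a b hma hmb ⟨a₀, ha₀, ha⟩ hab R hR hb => ?_⟩
  have D : IsLTFTData h a b :=
    ⟨h1, h_memLp, hτ₁, fun τ => ha₀.trans_le (ha τ), hab, hma, hmb⟩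
  have henv : ∀ ε : ℝ, 0 < ε → ∀ W : ℝ, W₀ ε ≤ W →
      HasLinearVolumeEnvelopes (ltftMeasure μ₃) (ltftAtom h a b)
        (timeLimitedFourier R) (ltftEnvelope a R W) ε := by
    intro ε hε W hW
    obtain ⟨hW1, l, hl, hlW, hlt⟩ := hW₀ ε hε W hW
    exact D.hasLinearVolumeEnvelopes h_supp μ₃ (hτ₁.trans hτ) hR hb ha₀ ha hδ hκ hh hW1 hl hlW hlt
  exact ⟨⟨D.isContinuousFrame μ₃ hb ha₀ ha hδ hκ hh, isDiscretization_timeLimitedFourier hR,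
    fun ε hε => ⟨_, henv ε hε _ le_rfl⟩⟩, henv⟩

end
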